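/- Let $(M,g)$ be a smooth time-oriented Lorentz manifold of dimension $n$. A subset $H\subset M$ is called a *horizon* if (1) it is a topological hypersurface, i.e. every $p\in H$ has an open neighbourhood in $M$ that is mapped homeomorphically onto an open subset of $\mathbb R^n$ so that $H$ corresponds to the part of an affine hyperplane in it; (2) it is achronal, i.e. no point of $H$ lies in the chronological past of a point of $H$; and (3) for every $p\in H$ there is a past inextendible, past directed, lightlike geodesic $\gamma:[0,\alpha)\to H$, $0<\alpha\le\infty$, with $\gamma(0)=p$. For an open set $U\subset M$ and $q\in U$, let $I^-_U(q)$ denote the chronological past of $q$ in the spacetime $(U,g|_U)$, defined by piecewise smooth timelike curves in $U$. For a set $S\subset U$ that is achronal in $(U,g|_U)$ let $$D^+_U(S)=\{z\in U : \text{every past directed causal curve from } z \text{ in } U \text{ that is past inextendible in } U \text{ meets } S\},\qquad H^+_U(S)=\partial D^+_U(S)\setminus\overline S$$ (causal curves are piecewise smooth, boundary and closure are taken in $U$) be its future Cauchy development and its future Cauchy horizon in $(U,g|_U)$. **Lemma.** Every horizon locally coincides with a Cauchy horizon. More precisely, let $H$ be a horizon in $(M,g)$ and $p\in H$. Then there are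 an open neighbourhood $U$ of $p$ in $M$ with a smooth chart $\varphi:U\to\mathbb B^n$ onto the open unit ball of $\mathbb R^n$, an affine hyperplane of $\mathbb R^n$ such that $F=\{x\in U:\varphi(x)\text{ lies in this hyperplane}\}$ is spacelike, and an open neighbourhood $U_p$ of $p$ with $\overline{U_p}\subset U$, such that the set $$S=\bigcup_{q\in\overline{U_p}\cap H} I^-_U(q)\cap F$$ is achronal in $(U,g|_U)$ and $$H\cap U_p=H^+_U(S)\cap U_p .$$ -/

import Mathlib

open Set Filter Topology Manifold
open scoped ContDiff

noncomputable section

/-- `ℝⁿ` with its Euclidean norm. -/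
abbrev Rn (n : ℕ) : Type := EuclideanSpace ℝ (Fin n)

/-- A smooth Lorentz metric (signature `(-,+,…,+)`) on an `n`-manifold `M`: a smooth field of
symmetric bilinear forms such that each tangent space has a vector `v` with `g(v,v) < 0` on whose
orthogonal complement `g` is positive definite. -/
structure LorentzMetric (n : ℕ) (M : Type*) [TopologicalSpace M] [ChartedSpace (Rn n) M]
    [IsManifold 𝓘(ℝ, Rn n) ∞ M] where
  /-- the bilinear form on the tangent space at `x` -/
  inner (x : M) :
    TangentSpace 𝓘(ℝ, Rn n) x →L[ℝ] TangentSpace 𝓘(ℝ, Rn n) x →L[ℝ] ℝ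
  symm (x : M) (v w : TangentSpace 𝓘(ℝ, Rn n) x) : inner x v w = inner x w v
  signature (x : M) : ∃ v : TangentSpace 𝓘(ℝ, Rn n) x, inner x v v < 0 ∧
    ∀ w : TangentSpace 𝓘(ℝ, Rn n) x, inner x v w = 0 → w ≠ 0 → 0 < inner x w w
  contMDiff : ContMDiff 𝓘(ℝ, Rn n)
    (𝓘(ℝ, Rn n).prod 𝓘(ℝ, Rn n →L[ℝ] Rn n →L[ℝ] ℝ)) ∞
    (fun x ↦ Bundle.TotalSpace.mk' (Rn n →L[ℝ] Rn n →L[ℝ] ℝ)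
      (E := fun x : M ↦
        TangentSpace 𝓘(ℝ, Rn n) x →L[ℝ] TangentSpace 𝓘(ℝ, Rn n) x →L[ℝ] ℝ) x (inner x))

/-- A time-oriented Lorentz metric: a Lorentz metric with a continuous timelike vector field,
which is declared to be future directed. -/
structure TimeOrientedLorentzMetric (n : ℕ) (M : Type*) [TopologicalSpace M]
    [ChartedSpace (Rn n) M] [IsManifold 𝓘(ℝ, Rn n) ∞ M] extends LorentzMetric n M where
  /-- the future directed timelike vector field -/
  future (x : M) : TangentSpace 𝓘(ℝ, Rn n) x
  timelike (x : M) : inner x (future x) (future x) < 0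
  continuous_future :
    Continuous (fun x ↦ (⟨x, future x⟩ : TangentBundle 𝓘(ℝ, Rn n) M))

namespace TimeOrientedLorentzMetric

variable {n : ℕ} {M : Type*} [TopologicalSpace M] [ChartedSpace (Rn n) M]
  [IsManifold 𝓘(ℝ, Rn n) ∞ M] (g : TimeOrientedLorentzMetric n M)

/-! ### Tangent vectors -/

/-- The past directed timelike vectors at `x`. -/
def pastTimelike (x : M) : Set (TangentSpace 𝓘(ℝ, Rn n) x) :=
  {v | g.inner x v v < 0 ∧ 0 < g.inner x (g.future x) v}

/-- The past directed causal (timelike or lightlike, nonzero) vectors at `x`. -/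
def pastCausal (x : M) : Set (TangentSpace 𝓘(ℝ, Rn n) x) :=
  {v | v ≠ 0 ∧ g.inner x v v ≤ 0 ∧ 0 < g.inner x (g.future x) v}

/-- The past directed lightlike vectors at `x`. -/
def pastLightlike (x : M) : Set (TangentSpace 𝓘(ℝ, Rn n) x) :=
  {v | v ≠ 0 ∧ g.inner x v v = 0 ∧ 0 < g.inner x (g.future x) v}

/-! ### Curves -/

/-- Velocity at `t` of a curve with parameter domain `s` (one-sided at an endpoint of `s`). -/
def velocity (γ : ℝ → M) (s : Set ℝ) (t : ℝ) : TangentSpace 𝓘(ℝ, Rn n) (γ t) :=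
  mfderivWithin 𝓘(ℝ, ℝ) 𝓘(ℝ, Rn n) γ s t (1 : ℝ)

/-- `γ` is a piecewise smooth curve on the interval `s ⊆ [0, ∞)` all of whose velocity vectors
(both one-sided ones at a break) lie in the cones `C`. The breaks form a set `P` of which only
finitely many lie before any given parameter of `s`. -/
def IsPiecewiseSmoothDirected (C : (x : M) → Set (TangentSpace 𝓘(ℝ, Rn n) x))
    (γ : ℝ → M) (s : Set ℝ) : Prop :=
  ∃ P : Set ℝ, (∀ t ∈ s, (P ∩ Icc 0 t).Finite) ∧
    ∀ a b : ℝ, a < b → Icc a b ⊆ s → Disjoint (Ioo a b) P →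
      ContMDiffOn 𝓘(ℝ, ℝ) 𝓘(ℝ, Rn n) ∞ γ (Icc a b) ∧
        ∀ t ∈ Icc a b, velocity γ (Icc a b) t ∈ C (γ t)

/-- The half-open interval `[0, b)`, where `b = ∞` is allowed. -/
def rayDomain (b : EReal) : Set ℝ := {t | 0 ≤ t ∧ (t : EReal) < b}

/-- The point `q` is an endpoint of `γ : [0, b) → M`, i.e. `γ t → q` as `t → b`. -/
def IsEndpoint (γ : ℝ → M) (b : EReal) (q : M) : Prop :=
  ∀ V ∈ 𝓝 q, ∃ t₀ ∈ rayDomain b, ∀ t ∈ rayDomain b, t₀ ≤ t → γ t ∈ V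

/-- The coefficients of the metric in a chart `φ`: the form `(φ⁻¹)^* g` at `y ∈ φ.target`. -/
def chartMetric (φ : OpenPartialHomeomorph M (Rn n)) (y u v : Rn n) : ℝ :=
  g.inner (φ.symm y)
    (mfderiv 𝓘(ℝ, Rn n) 𝓘(ℝ, Rn n) φ.symm y u)
    (mfderiv 𝓘(ℝ, Rn n) 𝓘(ℝ, Rn n) φ.symm y v)

/-- The Christoffel symbols of the first kind in the chart `φ`, contracted with `u`, `v`, `w`:
`½ (∂_u g(v,w) + ∂_v g(u,w) - ∂_w g(u,v))` at `y`. -/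
def christoffel (φ : OpenPartialHomeomorph M (Rn n)) (y u v w : Rn n) : ℝ :=
  (fderiv ℝ (fun z ↦ g.chartMetric φ z v w) y u
    + fderiv ℝ (fun z ↦ g.chartMetric φ z u w) y v
    - fderiv ℝ (fun z ↦ g.chartMetric φ z u v) y w) / 2

/-- `γ` is a geodesic of the Levi-Civita connection on the interval `s`: it is smooth and in each
chart `x(t) = φ(γ(t))` satisfies `g(x'', w) + Γ(x', x', w) = 0` for all `w` (the geodesic equation
with lowered index). -/
def IsGeodesicOn (γ : ℝ → M) (s : Set ℝ) : Prop :=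
  ContMDiffOn 𝓘(ℝ, ℝ) 𝓘(ℝ, Rn n) ∞ γ s ∧
    ∀ t ∈ s, ∀ φ ∈ atlas (Rn n) M, γ t ∈ φ.source → ∀ w : Rn n,
      g.chartMetric φ (φ (γ t))
          (derivWithin (fun τ ↦ derivWithin (fun σ ↦ φ (γ σ)) s τ) s t) w
        + g.christoffel φ (φ (γ t)) (derivWithin (fun σ ↦ φ (γ σ)) s t)
            (derivWithin (fun σ ↦ φ (γ σ)) s t) w = 0

/-! ### Causality in the open submanifold `(U, g|_U)`

The curves of the spacetime `(U, g|_U)` are the curves of `M` that lie in `U`; taking `U = univ`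
gives the notions in `M` itself. -/

/-- The chronological past `I⁻(q)` of `q` in `(U, g|_U)`. -/
def chronPast (U : Set M) (q : M) : Set M :=
  {x | ∃ γ : ℝ → M, IsPiecewiseSmoothDirected g.pastTimelike γ (Icc 0 1) ∧
    (∀ t ∈ Icc (0 : ℝ) 1, γ t ∈ U) ∧ γ 0 = q ∧ γ 1 = x}

/-- `A` is achronal in `(U, g|_U)`: no two points of `A` are chronologically related. -/
def IsAchronal (U A : Set M) : Prop :=
  ∀ x ∈ A, ∀ y ∈ A, x ∉ g.chronPast U y

/-- `γ : [0, b) → U` is a past directed causal curve from `z` which is past inextendible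
in `(U, g|_U)`. -/
def IsPastInextendibleCausal (U : Set M) (z : M) (γ : ℝ → M) (b : EReal) : Prop :=
  0 < b ∧ IsPiecewiseSmoothDirected g.pastCausal γ (rayDomain b) ∧
    (∀ t ∈ rayDomain b, γ t ∈ U) ∧ γ 0 = z ∧ ∀ q ∈ U, ¬ IsEndpoint γ b q

/-- The future Cauchy development `D⁺(S)` in `(U, g|_U)`. -/
def cauchyDevelopment (U S : Set M) : Set M :=
  {z ∈ U | ∀ (γ : ℝ → M) (b : EReal), g.IsPastInextendibleCausal U z γ b →
    ∃ t ∈ rayDomain b, γ t ∈ S}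

/-- The future Cauchy horizon `H⁺(S) = ∂D⁺(S) \ S̄` in `(U, g|_U)`; for open `U ⊆ M` and subsets
of `U`, boundary and closure in `U` are those in `M` intersected with `U`. -/
def cauchyHorizon (U S : Set M) : Set M :=
  U ∩ (frontier (g.cauchyDevelopment U S) \ closure S)

/-! ### Horizons -/

/-- `H` is a horizon in `(M, g)`: an achronal topological hypersurface such that from each of its
points there starts a past directed, past inextendible lightlike geodesic contained in `H`. -/
structure IsHorizon (H : Set M) : Prop where
  /-- near each of its points, `H` is mapped by some local homeomorphism of `M` to `ℝⁿ` onto a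
  piece of an affine hyperplane -/
  hypersurface : ∀ p ∈ H, ∃ e : OpenPartialHomeomorph M (Rn n), p ∈ e.source ∧
    ∃ (l : Rn n →L[ℝ] ℝ) (c : ℝ), l ≠ 0 ∧ ∀ x ∈ e.source, x ∈ H ↔ l (e x) = c
  achronal : g.IsAchronal univ H
  generator : ∀ p ∈ H, ∃ (γ : ℝ → M) (b : EReal), 0 < b ∧ g.IsGeodesicOn γ (rayDomain b) ∧
    (∀ t ∈ rayDomain b, velocity γ (rayDomain b) t ∈ g.pastLightlike (γ t)) ∧
    (∀ t ∈ rayDomain b, γ t ∈ H) ∧ γ 0 = p ∧ ∀ q : M, ¬ IsEndpoint γ b q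

/-- In the chart `φ`, the hyperplane `l = c` is spacelike: `g` is positive definite on its tangent
spaces at all its points in the domain of the chart. -/
def IsSpacelikeHyperplane (φ : OpenPartialHomeomorph M (Rn n)) (l : Rn n →L[ℝ] ℝ) (c : ℝ) :
    Prop :=
  l ≠ 0 ∧ ∀ y ∈ φ.target, l y = c → ∀ u : Rn n, l u = 0 → u ≠ 0 → 0 < g.chartMetric φ y u u

/-- The part of `M` on which, in the chart `φ`, the equation `l = c` holds. -/
def chartHyperplane (φ : OpenPartialHomeomorph M (Rn n)) (l : Rn n →L[ℝ] ℝ) (c : ℝ) : Set M :=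
  {x ∈ φ.source | l (φ x) = c}

end TimeOrientedLorentzMetric

end

/-! Near `p` work in a chart onto the unit ball, centred at `p`, with a unit timelike direction `e`
and a linear time function `l`, `l e = 1`. The light cones are uniformly narrow around `e`: a causal
vector `w` satisfies `‖w‖ ≤ K |l w|`, and it is past directed exactly when `l w < 0` (`IsConeField`,
`exists_coneChart`).

Achronality forbids two points of `H` on one line parallel to `e`, while the flattening map of `H`
supplies points on both sides of `H` arbitrarily near `p`. Hence in a small cylinder around `p` the
horizon is the zero set of a continuous function that is negative at the bottom and positive at the
top (`exists_defining_function`). `F` is the hyperplane `l = -d` below this cylinder.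

A point `z` strictly below a point `q` of `H` on an axis line lies in `D⁺(S)`. The norm bound forces
each past inextendible causal curve from `z` to reach `F` before leaving the chart
(`exists_apply_eq`). Pushing the curve upwards along `e`, by an amount that starts at the distance
from `z` to `q` and vanishes on `F`, makes it timelike (`mem_chronPast_of_causal`), so its point on
`F` is in the past of `q` and belongs to `S` (`mem_cauchyDevelopment`).

A point strictly above a point of `H` does not lie in `D⁺(S)`. Descend along the axis to `H` and
follow a generator: the first part stays above `F`, the second stays in `H`, and `H` misses `S` by
achronality (`notMem_cauchyDevelopment`).

So inside the cylinder the sign of the defining function decides membership in `D⁺(S)`, and the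
frontier of `D⁺(S)` there is `H`. Since the cylinder lies above `F`, removing the closure of `S`
changes nothing. -/

noncomputable section

set_option linter.unusedSectionVars false

namespace TimeOrientedLorentzMetric

variable {n : ℕ} {M : Type*} [TopologicalSpace M] [ChartedSpace (Rn n) M]
  [IsManifold 𝓘(ℝ, Rn n) ∞ M] (g : TimeOrientedLorentzMetric n M)

/-! ### The metric and the time orientation in a chart -/

/-- The derivative of the inverse of a chart, as a map out of the model space. -/
def chartDeriv (φ : OpenPartialHomeomorph M (Rn n)) (y : Rn n) :
    Rn n →L[ℝ] TangentSpace 𝓘(ℝ, Rn n) (φ.symm y) :=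
  mfderiv 𝓘(ℝ, Rn n) 𝓘(ℝ, Rn n) φ.symm y

/-- The metric in a chart, as a bilinear form on the model space. -/
def chartForm (φ : OpenPartialHomeomorph M (Rn n)) (y : Rn n) : Rn n →L[ℝ] Rn n →L[ℝ] ℝ :=
  ((chartDeriv φ y).precomp ℝ).comp ((g.inner (φ.symm y)).comp (chartDeriv φ y))

/-- The linear form `g(future, ·)` in a chart. -/
def chartTime (φ : OpenPartialHomeomorph M (Rn n)) (y : Rn n) : Rn n →L[ℝ] ℝ :=
  (g.inner (φ.symm y) (g.future (φ.symm y))).comp (chartDeriv φ y)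

theorem chartForm_apply (φ : OpenPartialHomeomorph M (Rn n)) (y u v : Rn n) :
    g.chartForm φ y u v = g.inner (φ.symm y) (chartDeriv φ y u) (chartDeriv φ y v) := rfl

theorem chartTime_apply (φ : OpenPartialHomeomorph M (Rn n)) (y v : Rn n) :
    g.chartTime φ y v = g.inner (φ.symm y) (g.future (φ.symm y)) (chartDeriv φ y v) := rfl

theorem chartForm_comm (φ : OpenPartialHomeomorph M (Rn n)) (y u v : Rn n) :
    g.chartForm φ y u v = g.chartForm φ y v u := g.symm _ _ _

variable {φ : OpenPartialHomeomorph M (Rn n)}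

theorem mdifferentiable_of_mem_maximalAtlas
    (hφ : φ ∈ IsManifold.maximalAtlas 𝓘(ℝ, Rn n) ∞ M) :
    φ.MDifferentiable 𝓘(ℝ, Rn n) 𝓘(ℝ, Rn n) :=
  ⟨(contMDiffOn_of_mem_maximalAtlas hφ).mdifferentiableOn (by simp),
    (contMDiffOn_symm_of_mem_maximalAtlas hφ).mdifferentiableOn (by simp)⟩

theorem chartDeriv_bijective (hφ : φ ∈ IsManifold.maximalAtlas 𝓘(ℝ, Rn n) ∞ M) {y : Rn n}
    (hy : y ∈ φ.target) : Function.Bijective (chartDeriv φ y) :=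
  (mdifferentiable_of_mem_maximalAtlas hφ).symm.mfderiv_bijective hy

/-- This section is the tangent map of `φ.symm` along the constant field `u`. Regularity of the
metric and of the time form in the chart then follows by applying bundle maps to such sections. -/
theorem contMDiffOn_chartDeriv (hφ : φ ∈ IsManifold.maximalAtlas 𝓘(ℝ, Rn n) ∞ M) (u : Rn n) :
    ContMDiffOn 𝓘(ℝ, Rn n) 𝓘(ℝ, Rn n).tangent ∞
      (fun y ↦ (⟨φ.symm y, chartDeriv φ y u⟩ : TangentBundle 𝓘(ℝ, Rn n) M)) φ.target := by
  have h := (contMDiffOn_symm_of_mem_maximalAtlas hφ).contMDiffOn_tangentMapWithin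
    (m := ∞) (by simp) φ.open_target.uniqueMDiffOn
  have hs : ContMDiffOn 𝓘(ℝ, Rn n) 𝓘(ℝ, Rn n).tangent ∞
      (fun y ↦ (⟨y, u⟩ : TangentBundle 𝓘(ℝ, Rn n) (Rn n))) φ.target :=
    contMDiffOn_vectorSpace_iff_contDiffOn.2 (contDiffOn_const (c := u))
  refine (h.comp hs (fun y hy ↦ hy)).congr fun y hy ↦ ?_
  simp only [tangentMapWithin, chartDeriv, Function.comp_apply,
    mfderivWithin_of_isOpen φ.open_target hy]
  rfl

theorem contDiffOn_chartForm (hφ : φ ∈ IsManifold.maximalAtlas 𝓘(ℝ, Rn n) ∞ M) :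
    ContDiffOn ℝ ∞ (g.chartForm φ) φ.target := by
  rw [contDiffOn_clm_apply]
  intro u
  rw [contDiffOn_clm_apply]
  intro v
  have hg := g.contMDiff.comp_contMDiffOn (contMDiffOn_symm_of_mem_maximalAtlas hφ)
  have h := ContMDiffOn.clm_bundle_apply₂ (E₃ := Bundle.Trivial M ℝ) hg
    (contMDiffOn_chartDeriv hφ u) (contMDiffOn_chartDeriv hφ v)
  rw [← contMDiffOn_iff_contDiffOn]
  intro y hy
  have := h y hy
  rw [Bundle.contMDiffWithinAt_totalSpace] at this
  simpa [chartForm_apply] using this.2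

theorem continuousOn_chartTime (hφ : φ ∈ IsManifold.maximalAtlas 𝓘(ℝ, Rn n) ∞ M) :
    ContinuousOn (g.chartTime φ) φ.target := by
  rw [continuousOn_clm_apply]
  intro v
  have hg := (g.contMDiff.comp_contMDiffOn (contMDiffOn_symm_of_mem_maximalAtlas hφ)).of_le
    (show (0 : WithTop ℕ∞) ≤ ∞ from zero_le)
  have hX : ContMDiffOn 𝓘(ℝ, Rn n) 𝓘(ℝ, Rn n).tangent 0
      (fun y ↦ (⟨φ.symm y, g.future (φ.symm y)⟩ : TangentBundle 𝓘(ℝ, Rn n) M)) φ.target :=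
    contMDiffOn_zero_iff.2 (g.continuous_future.comp_continuousOn φ.continuousOn_symm)
  have h := ContMDiffOn.clm_bundle_apply₂ (E₃ := Bundle.Trivial M ℝ) hg
    hX ((contMDiffOn_chartDeriv hφ v).of_le (show (0 : WithTop ℕ∞) ≤ ∞ from zero_le))
  rw [← contMDiffOn_zero_iff (I := 𝓘(ℝ, Rn n)) (I' := 𝓘(ℝ, ℝ))]
  intro y hy
  have := h y hy
  rw [Bundle.contMDiffWithinAt_totalSpace] at this
  simpa [chartTime_apply] using this.2

theorem velocity_eq_chartDeriv (hφ : φ ∈ IsManifold.maximalAtlas 𝓘(ℝ, Rn n) ∞ M) {x : ℝ → Rn n}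
    {s : Set ℝ} {t : ℝ} (hs : UniqueDiffWithinAt ℝ s t) (hx : DifferentiableWithinAt ℝ x s t)
    (hxt : x t ∈ φ.target) :
    velocity (n := n) (fun τ ↦ φ.symm (x τ)) s t = chartDeriv φ (x t) (derivWithin x s t) := by
  have h := mfderiv_comp_mfderivWithin (I := 𝓘(ℝ, ℝ)) (I' := 𝓘(ℝ, Rn n)) (I'' := 𝓘(ℝ, Rn n))
    (g := φ.symm) (f := x) (s := s) t
    ((mdifferentiable_of_mem_maximalAtlas hφ).mdifferentiableAt_symm hxt)
    hx.mdifferentiableWithinAt hs.uniqueMDiffWithinAt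
  rw [mfderivWithin_eq_fderivWithin] at h
  exact congrArg (fun A ↦ A (1 : ℝ)) h

end TimeOrientedLorentzMetric

/-! ### Fields of Lorentzian cones in a normed space -/

section Cones

variable {E : Type*} [NormedAddCommGroup E] [NormedSpace ℝ E]

/-- The cones of the quadratic forms `G y`, `y ∈ Ω`, together with the linear forms `T y` that
single out their past halves, are uniformly transversal to the kernel of `l` and contain `e`. -/
structure IsConeField (G : E → E →L[ℝ] E →L[ℝ] ℝ) (T : E → E →L[ℝ] ℝ) (Ω : Set E) (e : E)
    (l : E →L[ℝ] ℝ) (K L m : ℝ) : Prop where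
  one_le : 1 ≤ K
  pos : 0 < m
  nonneg : 0 ≤ L
  norm_axis : ‖e‖ = 1
  apply_axis : l e = 1
  comm : ∀ y ∈ Ω, ∀ u v, G y u v = G y v u
  norm_le : ∀ y ∈ Ω, ∀ w, G y w w ≤ 0 → ‖w‖ ≤ K * |l w|
  past_iff : ∀ y ∈ Ω, ∀ w, w ≠ 0 → G y w w ≤ 0 → (0 < T y w ↔ l w < 0)
  axis_neg : ∀ y ∈ Ω, G y e e < 0
  lipschitz : ∀ y ∈ Ω, ∀ y' ∈ Ω, ∀ w, G y w w - G y' w w ≤ L * ‖y - y'‖ * ‖w‖ ^ 2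
  le_axis : ∀ y ∈ Ω, ∀ w, l w < 0 → ‖w‖ ≤ K * |l w| → m * ‖w‖ ≤ G y w e

/-- Pulling back by `y ↦ r • y + y₀` multiplies the form by `r ^ 2 > 0`, which leaves the cones, and
hence `e`, `l` and `K`, unchanged. Only the quantitative constants `L` and `m` scale. -/
theorem IsConeField.rescale {G : E → E →L[ℝ] E →L[ℝ] ℝ} {T : E → E →L[ℝ] ℝ} {Ω Ω' : Set E} {e : E}
    {l : E →L[ℝ] ℝ} {K L m : ℝ} (h : IsConeField G T Ω e l K L m)
    {G' : E → E →L[ℝ] E →L[ℝ] ℝ} {T' : E → E →L[ℝ] ℝ} {r : ℝ} (hr : 0 < r) (y₀ : E)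
    (hΩ : ∀ y ∈ Ω', r • y + y₀ ∈ Ω)
    (hG : ∀ y ∈ Ω', ∀ u v, G' y u v = r ^ 2 * G (r • y + y₀) u v)
    (hT : ∀ y ∈ Ω', ∀ u, T' y u = r * T (r • y + y₀) u) :
    IsConeField G' T' Ω' e l K (r ^ 3 * L) (r ^ 2 * m) := by
  have hr2 : 0 < r ^ 2 := by positivity
  have hneg : ∀ y ∈ Ω', ∀ w, G' y w w ≤ 0 → G (r • y + y₀) w w ≤ 0 := fun y hy w hw ↦ by
    rw [hG y hy] at hw
    exact nonpos_of_mul_nonpos_right hw hr2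
  refine ⟨h.one_le, by have := h.pos; positivity, by have := h.nonneg; positivity, h.norm_axis,
    h.apply_axis, fun y hy u v ↦ ?_, fun y hy w hw ↦ h.norm_le _ (hΩ y hy) w (hneg y hy w hw),
    fun y hy w hw0 hw ↦ ?_, fun y hy ↦ ?_, fun y hy y' hy' w ↦ ?_, fun y hy w hw hw' ↦ ?_⟩
  · rw [hG y hy, hG y hy, h.comm _ (hΩ y hy)]
  · rw [← h.past_iff _ (hΩ y hy) w hw0 (hneg y hy w hw), hT y hy, mul_pos_iff_of_pos_left hr]
  · rw [hG y hy]
    exact mul_neg_of_pos_of_neg hr2 (h.axis_neg _ (hΩ y hy))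
  · have := h.lipschitz _ (hΩ y hy) _ (hΩ y' hy') w
    rw [hG y hy, hG y' hy', ← mul_sub]
    refine (mul_le_mul_of_nonneg_left this hr2.le).trans_eq ?_
    rw [add_sub_add_right_eq_sub, ← smul_sub, norm_smul, Real.norm_of_nonneg hr.le]
    ring
  · have := h.le_axis _ (hΩ y hy) w hw hw'
    rw [hG y hy, mul_assoc]
    exact mul_le_mul_of_nonneg_left this hr2.le

/-- A timelike vector and the linear form it defines, for a Lorentzian scalar product with a given
timelike vector `ξ`; nonzero causal vectors on which `ξ` is nonnegative lie below the kernel. -/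
theorem exists_timelike_axis {G : E →L[ℝ] E →L[ℝ] ℝ} (hG : ∀ u v, G u v = G v u) {v ξ : E}
    (hv : G v v < 0) (hpos : ∀ w, G v w = 0 → w ≠ 0 → 0 < G w w) (hξ : G ξ ξ < 0) :
    ∃ (e : E) (l : E →L[ℝ] ℝ), ‖e‖ = 1 ∧ l e = 1 ∧ G e e < 0 ∧ (∀ w, G w e = l w * G e e) ∧
      ∀ w, w ≠ 0 → G w w ≤ 0 → 0 ≤ G ξ w → l w < 0 := by
  have hv0 : v ≠ 0 := by rintro rfl; simp at hv
  have hξ0 : ξ ≠ 0 := by rintro rfl; simp at hξ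
  have hvξ : G v ξ ≠ 0 := fun h ↦ (hpos ξ h hξ0).not_gt hξ
  have hn : 0 < ‖v‖ := norm_pos_iff.2 hv0
  -- The sign of `a` puts `e = a • v` in the same half of the cone as `ξ`.
  obtain ⟨a, ha, hav, hneg⟩ : ∃ a : ℝ, a ≠ 0 ∧ ‖a • v‖ = 1 ∧ G (a • v) ξ < 0 := by
    rcases hvξ.lt_or_gt with h | h
    · refine ⟨‖v‖⁻¹, by positivity, by rw [norm_smul]; simp [hn.ne'], ?_⟩
      simpa using mul_neg_of_pos_of_neg (inv_pos.2 hn) h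
    · refine ⟨-‖v‖⁻¹, by simp [hv0], by rw [norm_smul]; simp [hn.ne'], ?_⟩
      simpa using mul_pos (inv_pos.2 hn) h
  set e := a • v with he
  have hee : G e e < 0 := by
    have : G e e = a ^ 2 * G v v := by simp [he]; ring
    rw [this]
    exact mul_neg_of_pos_of_neg (by positivity) hv
  have hepos : ∀ w, G e w = 0 → w ≠ 0 → 0 < G w w := fun w hw ↦ hpos w (by
    simpa [he, ha] using hw)
  have hl : ∀ w, ((G e e)⁻¹ • G e) w = G e w / G e e := fun w ↦ by
    simp [div_eq_inv_mul]
  refine ⟨e, (G e e)⁻¹ • G e, hav, ?_, hee, fun w ↦ ?_, fun w hw0 hw hξw ↦ ?_⟩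
  · rw [hl, div_self hee.ne]
  · rw [hl, div_mul_cancel₀ _ hee.ne, hG]
  · rw [hl]
    by_contra hcon
    have hew : G e w ≤ 0 := by
      by_contra! h
      exact hcon (div_neg_of_pos_of_neg h hee)
    rcases hew.eq_or_lt with h | h
    · exact (hepos w h hw0).not_ge hw
    -- This combination is orthogonal to `e`, so `G u u ≥ 0`; yet in its expansion no term is
    -- positive and the one with `G ξ ξ` is negative.
    · set u := G e w • ξ - G e ξ • w with hu
      have heu : G e u = 0 := by simp [hu]; ring
      have huu : G u u = G e w ^ 2 * G ξ ξ - 2 * (G e w * G e ξ) * G ξ w + G e ξ ^ 2 * G w w := by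
        simp [hu, hG w ξ]; ring
      have h1 : G e w ^ 2 * G ξ ξ < 0 := mul_neg_of_pos_of_neg (sq_pos_of_neg h) hξ
      have h2 : 0 ≤ 2 * (G e w * G e ξ) * G ξ w :=
        mul_nonneg (by have := mul_pos_of_neg_of_neg h hneg; positivity) hξw
      have h3 : G e ξ ^ 2 * G w w ≤ 0 := mul_nonpos_of_nonneg_of_nonpos (by positivity) hw
      have h4 : 0 ≤ G u u := by
        rcases eq_or_ne u 0 with h0 | h0
        · simp [h0]
        · exact (hepos u heu h0).le
      linarith

/-- A field of Lorentzian scalar products which is `C¹` at a point, with a time orientation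
continuous there, is a cone field near this point. -/
theorem exists_isConeField [FiniteDimensional ℝ E] {G : E → E →L[ℝ] E →L[ℝ] ℝ}
    {T : E → E →L[ℝ] ℝ} {y₀ v ξ : E} (hcomm : ∀ y u v, G y u v = G y v u)
    (hv : G y₀ v v < 0) (hpos : ∀ w, G y₀ v w = 0 → w ≠ 0 → 0 < G y₀ w w)
    (hξ : G y₀ ξ ξ < 0) (hT : ∀ w, T y₀ w = G y₀ ξ w)
    (hGd : ContDiffAt ℝ 1 G y₀) (hTc : ContinuousAt T y₀) :
    ∃ (Ω : Set E) (e : E) (l : E →L[ℝ] ℝ) (K L m : ℝ), Ω ∈ 𝓝 y₀ ∧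
      IsConeField G T Ω e l K L m := by
  obtain ⟨e, l, he, hle, hee, hGe, hneg⟩ := exists_timelike_axis (hcomm y₀) hv hpos hξ
  have hGc : ContinuousAt G y₀ := hGd.continuousAt
  obtain ⟨κ, hκ, hcone⟩ : ∃ κ > 0, ∀ᶠ y in 𝓝 y₀, ∀ w ∈ Metric.sphere (0 : E) 1,
      G y w w ≤ 0 → 0 ≤ T y w → l w < -κ := by
    -- The margin `κ` is treated as a variable near `0`, so that compactness of the unit sphere
    -- gives one margin and one neighbourhood of `y₀` for all directions. At each direction one of
    -- three open conditions holds at `y₀`: spacelike, negative time form, or `l w < 0`.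
    have key : ∀ᶠ q : ℝ × E in 𝓝 (0, y₀), ∀ w ∈ Metric.sphere (0 : E) 1,
        G q.2 w w ≤ 0 → 0 ≤ T q.2 w → l w < -q.1 := by
      refine (isCompact_sphere (0 : E) 1).eventually_forall_of_forall_eventually fun w hw ↦ ?_
      have hw0 : w ≠ 0 := by rintro rfl; simp at hw
      have hp2 : ContinuousAt (fun z : (ℝ × E) × E ↦ z.1.2) ((0, y₀), w) := by fun_prop
      have hp3 : ContinuousAt (fun z : (ℝ × E) × E ↦ z.2) ((0, y₀), w) := by fun_prop
      have c1 : ContinuousAt (fun z : (ℝ × E) × E ↦ G z.1.2 z.2 z.2) ((0, y₀), w) :=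
        ((hGc.comp_of_eq hp2 rfl).clm_apply hp3).clm_apply hp3
      have c2 : ContinuousAt (fun z : (ℝ × E) × E ↦ T z.1.2 z.2) ((0, y₀), w) :=
        (hTc.comp_of_eq hp2 rfl).clm_apply hp3
      by_cases h1 : 0 < G y₀ w w
      · filter_upwards [c1.eventually (lt_mem_nhds h1)] with z hz h
        exact absurd h hz.not_ge
      by_cases h2 : T y₀ w < 0
      · filter_upwards [c2.eventually (gt_mem_nhds h2)] with z hz _ h
        exact absurd h hz.not_ge
      have h3 := hneg w hw0 (not_lt.1 h1) (hT w ▸ not_lt.1 h2)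
      have c3 : ContinuousAt (fun z : (ℝ × E) × E ↦ l z.2 + z.1.1) ((0, y₀), w) := by fun_prop
      filter_upwards [c3.eventually (gt_mem_nhds (by simpa using h3))] with z hz _ _
      linarith
    have := (key.curry_nhds.filter_mono (nhdsWithin_le_nhds (s := Ioi 0))).and self_mem_nhdsWithin
    obtain ⟨κ, h, hκ⟩ := this.exists
    exact ⟨κ, hκ, h⟩
  have hscale : ∀ y, (∀ w ∈ Metric.sphere (0 : E) 1, G y w w ≤ 0 → 0 ≤ T y w → l w < -κ) →
      ∀ w, w ≠ 0 → G y w w ≤ 0 → 0 ≤ T y w → l w < -κ * ‖w‖ := by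
    intro y hy w hw0 hw hTw
    have hn : 0 < ‖w‖ := norm_pos_iff.2 hw0
    have h := hy (‖w‖⁻¹ • w) (by simp [norm_smul, hn.ne']) (by
      have : G y (‖w‖⁻¹ • w) (‖w‖⁻¹ • w) = (‖w‖⁻¹) ^ 2 * G y w w := by simp; ring
      rw [this]
      exact mul_nonpos_of_nonneg_of_nonpos (by positivity) hw) (by
      rw [map_smul, smul_eq_mul]; positivity)
    rw [map_smul, smul_eq_mul, inv_mul_lt_iff₀ hn] at h
    linarith
  set K := max 1 κ⁻¹ with hK
  have hK1 : 1 ≤ K := le_max_left _ _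
  have hK0 : 0 < K := by linarith
  have hKκ : 1 ≤ K * κ := by
    have := mul_le_mul_of_nonneg_right (le_max_right 1 κ⁻¹) hκ.le
    rwa [inv_mul_cancel₀ hκ.ne'] at this
  obtain ⟨L, t, ht, hlip⟩ := hGd.exists_lipschitzOnWith
  -- At `y₀` the cone bound gives `G y₀ w e ≥ 2 * m * ‖w‖`; a perturbation of the form by less than
  -- `m` costs at most half of this.
  set m := -G y₀ e e / (2 * K) with hm
  have hm0 : 0 < m := div_pos (by linarith) (by positivity)
  have h1 : ∀ᶠ y in 𝓝 y₀, G y e e < 0 :=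
    ((hGc.clm_apply continuousAt_const).clm_apply continuousAt_const).eventually
      (gt_mem_nhds hee)
  have h2 : ∀ᶠ y in 𝓝 y₀, ‖G y - G y₀‖ < m := by
    have hc : ContinuousAt (fun y ↦ (L : ℝ) * ‖y - y₀‖) y₀ := by fun_prop
    filter_upwards [ht, hc.eventually (gt_mem_nhds (by simpa using hm0))] with y hy hlt
    exact (hlip.norm_sub_le hy (mem_of_mem_nhds ht)).trans_lt hlt
  refine ⟨_, e, l, K, L, m, inter_mem (inter_mem ht hcone) (inter_mem h1 h2), hK1, hm0, L.2, he,
    hle, fun y _ ↦ hcomm y, ?_, ?_, fun y hy ↦ hy.2.1, ?_, ?_⟩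
  · rintro y ⟨⟨-, hy⟩, -⟩ w hw
    rcases eq_or_ne w 0 with rfl | hw0
    · simp
    have hn : 0 < ‖w‖ := norm_pos_iff.2 hw0
    -- One of `w` and `-w` has nonnegative time form, and the margin applies to that one.
    have : κ * ‖w‖ ≤ |l w| := by
      rcases le_total 0 (T y w) with hTw | hTw
      · have := hscale y hy w hw0 hw hTw
        exact le_abs.2 (Or.inr (by linarith))
      · have := hscale y hy (-w) (neg_ne_zero.2 hw0) (by simpa using hw) (by simpa using hTw)
        rw [map_neg, norm_neg] at this
        exact le_abs.2 (Or.inl (by linarith))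
    calc ‖w‖ ≤ K * κ * ‖w‖ := le_mul_of_one_le_left hn.le hKκ
      _ = K * (κ * ‖w‖) := by ring
      _ ≤ _ := by gcongr
  · rintro y ⟨⟨-, hy⟩, -⟩ w hw0 hw
    have hn : 0 < ‖w‖ := norm_pos_iff.2 hw0
    have hκn := mul_pos hκ hn
    constructor
    · intro hTw
      have := hscale y hy w hw0 hw hTw.le
      linarith
    · intro hlw
      by_contra! hTw
      have := hscale y hy (-w) (neg_ne_zero.2 hw0) (by simpa using hw) (by simpa using hTw)
      rw [map_neg, norm_neg] at this
      linarith
  · rintro y ⟨⟨hy, -⟩, -⟩ y' ⟨⟨hy', -⟩, -⟩ w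
    have h := hlip.norm_sub_le hy hy'
    calc G y w w - G y' w w = (G y - G y') w w := by simp
      _ ≤ ‖(G y - G y') w w‖ := le_abs_self _
      _ ≤ ‖G y - G y'‖ * ‖w‖ * ‖w‖ := (G y - G y').le_opNorm₂ w w
      _ ≤ (L * ‖y - y'‖) * ‖w‖ * ‖w‖ := by gcongr
      _ = _ := by ring
  · rintro y ⟨-, -, hy⟩ w hlw hw
    have h : |(G y - G y₀) w e| ≤ m * ‖w‖ := by
      refine ((G y - G y₀).le_opNorm₂ w e).trans ?_
      rw [he, mul_one]
      exact mul_le_mul_of_nonneg_right (le_of_lt hy) (norm_nonneg w)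
    have h' := (abs_le.1 h).1
    rw [sub_apply, sub_apply, hGe] at h'
    have : 2 * m * ‖w‖ ≤ l w * G y₀ e e := by
      rw [abs_of_neg hlw] at hw
      calc 2 * m * ‖w‖ ≤ 2 * m * (K * -l w) := by gcongr
        _ = _ := by rw [hm]; field_simp
    linarith

end Cones

/-! ### Existence of charts adapted to the light cones -/

namespace TimeOrientedLorentzMetric

variable {n : ℕ} {M : Type*} [TopologicalSpace M] [ChartedSpace (Rn n) M]
  [IsManifold 𝓘(ℝ, Rn n) ∞ M] (g : TimeOrientedLorentzMetric n M)

/-- Around each point there is a chart onto the unit ball in which the light cones form a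
cone field. -/
theorem exists_coneChart (p : M) :
    ∃ φ ∈ IsManifold.maximalAtlas 𝓘(ℝ, Rn n) ∞ M, p ∈ φ.source ∧ φ p = 0 ∧
      φ.target = Metric.ball 0 1 ∧ ∃ (e : Rn n) (l : Rn n →L[ℝ] ℝ) (K L m : ℝ),
        IsConeField (g.chartForm φ) (g.chartTime φ) (Metric.ball 0 1) e l K L m := by
  set ψ := chartAt (Rn n) p with hψdef
  have hψ : ψ ∈ IsManifold.maximalAtlas 𝓘(ℝ, Rn n) ∞ M :=
    IsManifold.chart_mem_maximalAtlas p
  have hp : p ∈ ψ.source := mem_chart_source _ p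
  set y₀ := ψ p with hy₀
  have hy : y₀ ∈ ψ.target := ψ.map_source hp
  have hnhds : ψ.target ∈ 𝓝 y₀ := ψ.open_target.mem_nhds hy
  obtain ⟨v', hv', hpos'⟩ := g.signature (ψ.symm y₀)
  obtain ⟨v, rfl⟩ := (chartDeriv_bijective hψ hy).2 v'
  obtain ⟨ξ, hξ⟩ := (chartDeriv_bijective hψ hy).2 (g.future (ψ.symm y₀))
  obtain ⟨Ω, e, l, K, L, m, hΩ, hcone⟩ := exists_isConeField (G := g.chartForm ψ)
    (T := g.chartTime ψ) (y₀ := y₀) (v := v) (ξ := ξ) (g.chartForm_comm ψ) hv'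
    (fun w hw hw0 ↦ hpos' _ hw
      ((map_ne_zero_iff _ (chartDeriv_bijective hψ hy).1).2 hw0))
    (by rw [chartForm_apply, hξ]; exact g.timelike _)
    (fun w ↦ by rw [chartForm_apply, hξ, chartTime_apply])
    (((g.contDiffOn_chartForm hψ).contDiffAt hnhds).of_le (by exact_mod_cast le_top))
    ((g.continuousOn_chartTime hψ).continuousAt hnhds)
  obtain ⟨r, hr, hball⟩ := Metric.mem_nhds_iff.1 (inter_mem hΩ hnhds)
  set A := OpenPartialHomeomorph.unitBallBall (E := Rn n) y₀ r hr
  have hAs : A.source = Metric.ball 0 1 := rfl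
  have hAmap : ∀ y ∈ Metric.ball (0 : Rn n) 1, A y ∈ Metric.ball y₀ r := fun y hy' ↦
    A.map_source hy'
  -- An arbitrary chart is restricted to a ball on which the cone estimates hold, and this ball is
  -- rescaled to the unit ball.
  set φ := (A.trans ψ.symm).symm with hφdef
  have htarget : φ.target = Metric.ball 0 1 := by
    ext y
    simp only [hφdef, OpenPartialHomeomorph.symm_target, OpenPartialHomeomorph.trans_source,
      OpenPartialHomeomorph.symm_source, hAs, mem_inter_iff, mem_preimage]
    exact ⟨fun h ↦ h.1, fun h ↦ ⟨h, (hball (hAmap y h)).2⟩⟩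
  have hAd : ContDiff ℝ ∞ A := OpenPartialHomeomorph.contDiff_unitBallBall hr
  have hAd' : ContDiff ℝ ∞ A.symm := OpenPartialHomeomorph.contDiff_unitBallBall_symm hr
  have hAapply : ∀ y, A y = r • y + y₀ := fun y ↦ rfl
  have hφ : φ ∈ IsManifold.maximalAtlas 𝓘(ℝ, Rn n) ∞ M := by
    refine φ.mem_maximalAtlas_of_contMDiffOn ?_ ?_
    · exact hAd'.contMDiff.comp_contMDiffOn
        ((contMDiffOn_of_mem_maximalAtlas hψ).mono fun x hx ↦ hx.1)
    · exact (contMDiffOn_symm_of_mem_maximalAtlas hψ).comp hAd.contMDiff.contMDiffOn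
        fun y hy' ↦ (hball (hAmap y (htarget ▸ hy'))).2
  have hderiv : ∀ y ∈ Metric.ball (0 : Rn n) 1, ∀ u,
      chartDeriv φ y u = r • chartDeriv ψ (A y) u := by
    intro y hy' u
    have h1 : HasMFDerivAt 𝓘(ℝ, Rn n) 𝓘(ℝ, Rn n) A y
        (r • ContinuousLinearMap.id ℝ (Rn n)) := by
      refine HasFDerivAt.hasMFDerivAt ?_
      exact ((hasFDerivAt_id y).const_smul r).add_const y₀
    have h2 := (mdifferentiable_of_mem_maximalAtlas hψ).mdifferentiableAt_symm
      (hball (hAmap y hy')).2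
    have h3 := (h2.hasMFDerivAt.comp y h1).mfderiv
    have h4 : chartDeriv φ y = (chartDeriv ψ (A y)).comp (r • ContinuousLinearMap.id ℝ (Rn n)) :=
      h3
    rw [h4]
    simp only [ContinuousLinearMap.comp_smul, ContinuousLinearMap.comp_id]
    rfl
  refine ⟨φ, hφ, ⟨hp, ?_⟩, ?_, htarget, e, l, K, _, _,
    hcone.rescale hr y₀ (fun y hy' ↦ (hball (hAmap y hy')).1) (fun y hy' u v ↦ ?_)
      (fun y hy' u ↦ ?_)⟩
  · exact Metric.mem_ball_self hr
  · have : A 0 = y₀ := by simp [hAapply]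
    change A.symm (ψ p) = 0
    rw [← hy₀, ← this]
    exact A.left_inv (Metric.mem_ball_self one_pos)
  · rw [chartForm_apply, hderiv y hy', hderiv y hy']
    change g.inner (ψ.symm (A y)) (r • chartDeriv ψ (A y) u) (r • chartDeriv ψ (A y) v) =
      r ^ 2 * g.inner (ψ.symm (A y)) (chartDeriv ψ (A y) u) (chartDeriv ψ (A y) v)
    simp
    ring
  · rw [chartTime_apply, hderiv y hy']
    change g.inner (ψ.symm (A y)) (g.future (ψ.symm (A y))) (r • chartDeriv ψ (A y) u) =
      r * g.inner (ψ.symm (A y)) (g.future (ψ.symm (A y))) (chartDeriv ψ (A y) u)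
    simp

end TimeOrientedLorentzMetric

/-! ### Isolation of the breaks of a piecewise smooth curve -/

theorem exists_Ioo_right_disjoint {Q : Set ℝ} (hQ : Q.Finite) {t b : ℝ} (htb : t < b) :
    ∃ t' ∈ Ioc t b, Disjoint (Ioo t t') Q := by
  -- The parameter `t` may itself be a break, so only the other points of `Q` are avoided.
  have : (Q \ {t})ᶜ ∈ 𝓝 t := (hQ.subset sdiff_subset).isClosed.isOpen_compl.mem_nhds (by simp)
  obtain ⟨ε, hε, h⟩ := Metric.mem_nhds_iff.1 this
  refine ⟨min b (t + ε / 2), ⟨lt_min htb (by linarith), min_le_left _ _⟩, ?_⟩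
  rw [disjoint_left]
  rintro τ ⟨h1, h2⟩ hτ
  have h3 : τ < t + ε / 2 := h2.trans_le (min_le_right _ _)
  exact h (a := τ) (by rw [Metric.mem_ball, Real.dist_eq, abs_lt]; constructor <;> linarith)
    ⟨hτ, h1.ne'⟩

theorem exists_Ioo_left_disjoint {Q : Set ℝ} (hQ : Q.Finite) {a t : ℝ} (hat : a < t) :
    ∃ t' ∈ Ico a t, Disjoint (Ioo t' t) Q := by
  obtain ⟨t', ht', h⟩ := exists_Ioo_right_disjoint (hQ.preimage (f := fun x : ℝ ↦ -x)
    neg_injective.injOn) (neg_lt_neg hat)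
  refine ⟨-t', ⟨by linarith [ht'.2], by linarith [ht'.1]⟩, ?_⟩
  rw [disjoint_left] at h ⊢
  intro τ hτ hτQ
  exact h (a := -τ) ⟨by linarith [hτ.2], by linarith [hτ.1]⟩ (by simpa using hτQ)

namespace TimeOrientedLorentzMetric

variable {n : ℕ} {M : Type*} [TopologicalSpace M] [ChartedSpace (Rn n) M]
  [IsManifold 𝓘(ℝ, Rn n) ∞ M] (g : TimeOrientedLorentzMetric n M)

/-! ### Smooth pieces of curves -/

/-- `γ` is smooth on `[a, b]` with velocities in the cones `C`. -/
def IsSmoothDirected (C : (x : M) → Set (TangentSpace 𝓘(ℝ, Rn n) x)) (γ : ℝ → M) (a b : ℝ) :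
    Prop :=
  ContMDiffOn 𝓘(ℝ, ℝ) 𝓘(ℝ, Rn n) ∞ γ (Icc a b) ∧
    ∀ t ∈ Icc a b, velocity γ (Icc a b) t ∈ C (γ t)

variable {C : (x : M) → Set (TangentSpace 𝓘(ℝ, Rn n) x)} {γ : ℝ → M} {a b : ℝ}

/-- All tangent spaces are `Rn n` by definition, so vectors over propositionally equal points can be
compared without transport. -/
theorem mem_cone_congr {x y : M} (h : x = y) {v w : Rn n} (hvw : v = w) :
    (show TangentSpace 𝓘(ℝ, Rn n) x from v) ∈ C x ↔
      (show TangentSpace 𝓘(ℝ, Rn n) y from w) ∈ C y := by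
  subst h hvw
  rfl

theorem IsSmoothDirected.congr (h : IsSmoothDirected C γ a b) {γ' : ℝ → M}
    (hγ : EqOn γ' γ (Icc a b)) : IsSmoothDirected C γ' a b :=
  ⟨h.1.congr hγ, fun t ht ↦ (mem_cone_congr (hγ ht)
    (congrArg (fun A : ℝ →L[ℝ] Rn n ↦ A 1) (mfderivWithin_congr hγ (hγ ht)))).2 (h.2 t ht)⟩

theorem isSmoothDirected_of_subset {s : Set ℝ} (h : ContMDiffOn 𝓘(ℝ, ℝ) 𝓘(ℝ, Rn n) ∞ γ s)
    (hv : ∀ t ∈ s, velocity γ s t ∈ C (γ t)) (hab : a < b) (hs : Icc a b ⊆ s) :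
    IsSmoothDirected C γ a b := by
  refine ⟨h.mono hs, fun t ht ↦ ?_⟩
  have : velocity γ (Icc a b) t = velocity (n := n) γ s t :=
    congrArg (fun A ↦ A (1 : ℝ)) (mfderivWithin_subset hs
      ((uniqueDiffOn_Icc hab).uniqueMDiffOn t ht)
      ((h t (hs ht)).mdifferentiableWithinAt (by simp)))
  rw [this]
  exact hv t (hs ht)

/-- By the chain rule the velocity is multiplied by `r`, which the cones tolerate by `hC`. This
serves both for rescaling parameter intervals and for shifting them. -/
theorem IsSmoothDirected.comp_affine (h : IsSmoothDirected C γ a b) {r d a' b' : ℝ} (hr : 0 < r)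
    (hab : a' < b') (ha : a = r * a' + d) (hb : b = r * b' + d)
    (hC : ∀ x, ∀ v ∈ C x, r • v ∈ C x) : IsSmoothDirected C (fun t ↦ γ (r * t + d)) a' b' := by
  have hmaps : MapsTo (fun t : ℝ ↦ r * t + d) (Icc a' b') (Icc a b) := by
    intro t ht
    have h1 := mul_le_mul_of_nonneg_left ht.1 hr.le
    have h2 := mul_le_mul_of_nonneg_left ht.2 hr.le
    constructor <;> dsimp only <;> linarith
  have hsm : ContDiff ℝ ∞ (fun t : ℝ ↦ r * t + d) := by fun_prop
  refine ⟨h.1.comp hsm.contMDiff.contMDiffOn hmaps, fun t ht ↦ ?_⟩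
  have hd : HasFDerivAt (fun t : ℝ ↦ r * t + d) (r • ContinuousLinearMap.id ℝ ℝ) t :=
    ((hasFDerivAt_id t).const_mul r).add_const d
  have h1 := (((h.1 _ (hmaps ht)).mdifferentiableWithinAt (by simp)).hasMFDerivWithinAt.comp t
    hd.hasMFDerivAt.hasMFDerivWithinAt hmaps).mfderivWithin
      ((uniqueDiffOn_Icc hab).uniqueMDiffOn t ht)
  have h2 : velocity (n := n) (fun t ↦ γ (r * t + d)) (Icc a' b') t =
      r • velocity (n := n) γ (Icc a b) (r * t + d) := by
    refine (congrArg (fun A ↦ A (1 : ℝ)) h1).trans ?_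
    exact (mfderivWithin 𝓘(ℝ, ℝ) 𝓘(ℝ, Rn n) γ (Icc a b) (r * t + d)).map_smul r (1 : ℝ)
  rw [h2]
  exact hC _ _ (h.2 _ (hmaps ht))

theorem IsPiecewiseSmoothDirected.mono {s s' : Set ℝ} (h : IsPiecewiseSmoothDirected C γ s)
    (hs : s' ⊆ s) : IsPiecewiseSmoothDirected C γ s' := by
  obtain ⟨P, hP, h⟩ := h
  exact ⟨P, fun t ht ↦ hP t (hs ht), fun a b hab hsub ↦ h a b hab (hsub.trans hs)⟩

theorem IsPiecewiseSmoothDirected.exists_right (h : IsPiecewiseSmoothDirected C γ (Icc 0 b))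
    {t : ℝ} (ht : t ∈ Ico 0 b) : ∃ t' ∈ Ioc t b, IsSmoothDirected C γ t t' := by
  obtain ⟨P, hP, h⟩ := h
  obtain ⟨t', ht', hd⟩ := exists_Ioo_right_disjoint (hP b ⟨ht.1.trans ht.2.le, le_rfl⟩) ht.2
  refine ⟨t', ht', h t t' ht'.1 (Icc_subset_Icc ht.1 ht'.2) ?_⟩
  rw [disjoint_left] at hd ⊢
  exact fun τ hτ hτP ↦ hd hτ ⟨hτP, ht.1.trans hτ.1.le, hτ.2.le.trans ht'.2⟩

theorem IsPiecewiseSmoothDirected.exists_left (h : IsPiecewiseSmoothDirected C γ (Icc 0 b))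
    {t : ℝ} (ht : t ∈ Ioc 0 b) : ∃ t' ∈ Ico 0 t, IsSmoothDirected C γ t' t := by
  obtain ⟨P, hP, h⟩ := h
  obtain ⟨t', ht', hd⟩ := exists_Ioo_left_disjoint (hP b ⟨ht.1.le.trans ht.2, le_rfl⟩) ht.1
  refine ⟨t', ht', h t' t ht'.2 (Icc_subset_Icc ht'.1 ht.2) ?_⟩
  rw [disjoint_left] at hd ⊢
  exact fun τ hτ hτP ↦ hd hτ ⟨hτP, ht'.1.trans hτ.1.le, hτ.2.le.trans ht.2⟩

/-- Continuity is not part of the definition. It holds at breaks too, because the smooth pieces are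
closed intervals: each parameter is an endpoint of a piece on either available side. -/
theorem IsPiecewiseSmoothDirected.continuousOn (h : IsPiecewiseSmoothDirected C γ (Icc 0 b)) :
    ContinuousOn γ (Icc 0 b) := by
  intro t ht
  have hl : ContinuousWithinAt γ (Icc 0 t) t := by
    rcases ht.1.eq_or_lt with rfl | h0
    · simp
    · obtain ⟨t', ht', hs⟩ := h.exists_left ⟨h0, ht.2⟩
      exact (hs.1.continuousOn t ⟨ht'.2.le, le_rfl⟩).mono_of_mem_nhdsWithin
        (mem_of_superset (inter_mem_nhdsWithin _ (Ioi_mem_nhds ht'.2))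
          fun τ hτ ↦ ⟨le_of_lt hτ.2, hτ.1.2⟩)
  have hr : ContinuousWithinAt γ (Icc t b) t := by
    rcases ht.2.eq_or_lt with rfl | h0
    · simp
    · obtain ⟨t', ht', hs⟩ := h.exists_right ⟨ht.1, h0⟩
      exact (hs.1.continuousOn t ⟨le_rfl, ht'.1.le⟩).mono_of_mem_nhdsWithin
        (mem_of_superset (inter_mem_nhdsWithin _ (Iio_mem_nhds ht'.1))
          fun τ hτ ↦ ⟨hτ.1.1, le_of_lt hτ.2⟩)
  rw [← Icc_union_Icc_eq_Icc ht.1 ht.2]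
  exact hl.union hr

/-- A timelike curve with any compact parameter interval witnesses chronological precedence. -/
theorem mem_chronPast_of_curve {U : Set M} {q x : M} {T : ℝ} (hT : 0 < T)
    (h : IsPiecewiseSmoothDirected g.pastTimelike γ (Icc 0 T)) (hU : ∀ t ∈ Icc 0 T, γ t ∈ U)
    (h0 : γ 0 = q) (h1 : γ T = x) : x ∈ g.chronPast U q := by
  obtain ⟨P, hP, h⟩ := h
  have hmem : ∀ t ∈ Icc (0 : ℝ) 1, T * t ∈ Icc 0 T := fun t ht ↦
    ⟨mul_nonneg hT.le ht.1, mul_le_of_le_one_right hT.le ht.2⟩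
  refine ⟨fun t ↦ γ (T * t + 0), ⟨(fun t ↦ T * t) ⁻¹' P, fun t ht ↦ ?_, ?_⟩,
    fun t ht ↦ by simpa using hU _ (hmem t ht), by simpa using h0, by simpa using h1⟩
  · refine ((hP _ (hmem t ht)).preimage (mul_right_injective₀ hT.ne').injOn).subset ?_
    exact fun τ hτ ↦ ⟨hτ.1, mul_nonneg hT.le hτ.2.1, mul_le_mul_of_nonneg_left hτ.2.2 hT.le⟩
  · intro a b hab hsub hd
    have ha := hmem a (hsub ⟨le_rfl, hab.le⟩)
    have hb := hmem b (hsub ⟨hab.le, le_rfl⟩)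
    have hs : IsSmoothDirected g.pastTimelike γ (T * a) (T * b) := by
      refine h _ _ (by gcongr) (Icc_subset_Icc ha.1 hb.2) ?_
      rw [disjoint_left] at hd ⊢
      intro τ hτ hτP
      refine hd (a := τ / T) ⟨(lt_div_iff₀' hT).2 hτ.1, (div_lt_iff₀' hT).2 hτ.2⟩ ?_
      rwa [mem_preimage, mul_div_cancel₀ _ hT.ne']
    refine hs.comp_affine hT hab (by simp) (by simp) fun x v hv ↦ ⟨?_, ?_⟩
    · have : g.inner x (T • v) (T • v) = T ^ 2 * g.inner x v v := by simp; ring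
      rw [this]
      exact mul_neg_of_pos_of_neg (by positivity) hv.1
    · rw [map_smul, smul_eq_mul]
      exact mul_pos hT hv.2

theorem chronPast_mono {U V : Set M} (h : U ⊆ V) (q : M) : g.chronPast U q ⊆ g.chronPast V q :=
  fun _ ⟨γ, h1, h2, h3⟩ ↦ ⟨γ, h1, fun t ht ↦ h (h2 t ht), h3⟩

/-! ### Curves in a chart -/

variable {φ : OpenPartialHomeomorph M (Rn n)}

theorem isSmoothDirected_chart (hφ : φ ∈ IsManifold.maximalAtlas 𝓘(ℝ, Rn n) ∞ M) {x : ℝ → Rn n}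
    (hab : a < b) (hx : ContDiffOn ℝ ∞ x (Icc a b)) (hxt : ∀ t ∈ Icc a b, x t ∈ φ.target) :
    IsSmoothDirected C (fun t ↦ φ.symm (x t)) a b ↔
      ∀ t ∈ Icc a b, chartDeriv φ (x t) (derivWithin x (Icc a b) t) ∈ C (φ.symm (x t)) := by
  have h1 : ContMDiffOn 𝓘(ℝ, ℝ) 𝓘(ℝ, Rn n) ∞ (fun t ↦ φ.symm (x t)) (Icc a b) :=
    (contMDiffOn_symm_of_mem_maximalAtlas hφ).comp hx.contMDiffOn hxt
  rw [IsSmoothDirected, and_iff_right h1]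
  refine forall₂_congr fun t ht ↦ ?_
  rw [velocity_eq_chartDeriv hφ (uniqueDiffOn_Icc hab t ht)
    (hx.differentiableOn (by simp) t ht) (hxt t ht)]

theorem IsSmoothDirected.contDiffOn_chart (hφ : φ ∈ IsManifold.maximalAtlas 𝓘(ℝ, Rn n) ∞ M)
    (h : IsSmoothDirected C γ a b) (hγ : ∀ t ∈ Icc a b, γ t ∈ φ.source) :
    ContDiffOn ℝ ∞ (fun t ↦ φ (γ t)) (Icc a b) :=
  ((contMDiffOn_of_mem_maximalAtlas hφ).comp h.1 hγ).contDiffOn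

theorem IsSmoothDirected.chartDeriv_mem (hφ : φ ∈ IsManifold.maximalAtlas 𝓘(ℝ, Rn n) ∞ M)
    (hab : a < b) (h : IsSmoothDirected C γ a b) (hγ : ∀ t ∈ Icc a b, γ t ∈ φ.source)
    {t : ℝ} (ht : t ∈ Icc a b) :
    chartDeriv φ (φ (γ t)) (derivWithin (fun t ↦ φ (γ t)) (Icc a b) t) ∈
      C (φ.symm (φ (γ t))) :=
  (isSmoothDirected_chart hφ hab (h.contDiffOn_chart hφ hγ)
    fun t ht ↦ φ.map_source (hγ t ht)).1 (h.congr fun t ht ↦ φ.left_inv (hγ t ht)) t ht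

end TimeOrientedLorentzMetric

/-! ### Shearing causal vectors into timelike ones -/

section Cones

variable {E : Type*} [NormedAddCommGroup E] [NormedSpace ℝ E]
  {G : E → E →L[ℝ] E →L[ℝ] ℝ} {T : E → E →L[ℝ] ℝ} {Ω : Set E} {e : E}
  {l : E →L[ℝ] ℝ} {K L m : ℝ}

/-- Shearing along the axis of a cone field turns past causal vectors into past timelike ones, if
the slope of the shear dominates its size. -/
theorem IsConeField.shear_neg (h : IsConeField G T Ω e l K L m) {y : E} {f f' : ℝ} (hy : y ∈ Ω)
    (hy' : y + f • e ∈ Ω) (hf : 0 ≤ f) (hf' : 0 < f') (hff' : L * K / m * f ≤ f') {w : E}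
    (hw : G y w w ≤ 0) (hlw : l w < 0) :
    G (y + f • e) (w + (f' * l w) • e) (w + (f' * l w) • e) < 0 ∧ l (w + (f' * l w) • e) < 0 := by
  have hm := h.pos
  have hK : 0 < K := zero_lt_one.trans_le h.one_le
  have hle := h.apply_axis
  have hfl : f' * l w < 0 := mul_neg_of_pos_of_neg hf' hlw
  refine ⟨?_, by simp [hle]; linarith⟩
  have h1 := h.lipschitz _ hy' _ hy w
  have hn := h.norm_le y hy w hw
  have h2 := h.le_axis _ hy' w hlw hn
  have h3 := h.axis_neg _ hy'
  rw [add_sub_cancel_left, norm_smul, h.norm_axis, mul_one, Real.norm_of_nonneg hf] at h1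
  rw [abs_of_neg hlw] at hn
  have expand : G (y + f • e) (w + (f' * l w) • e) (w + (f' * l w) • e) =
      G (y + f • e) w w + 2 * (f' * l w) * G (y + f • e) w e
        + (f' * l w) ^ 2 * G (y + f • e) e e := by
    simp [h.comm _ hy' e w]
    ring
  have h4 : (f' * l w) ^ 2 * G (y + f • e) e e < 0 :=
    mul_neg_of_pos_of_neg (sq_pos_of_neg hfl) h3
  have h5 : f' * -l w * (m * ‖w‖) ≤ f' * -l w * G (y + f • e) w e :=
    mul_le_mul_of_nonneg_left h2 (mul_nonneg hf'.le (by linarith))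
  -- The error from moving the base point by `f • e` is at most half of the gain in the cross term
  -- `2 * (f' * l w) * G w e`; this is what `hff'` is made for.
  have h6 : L * f * ‖w‖ ^ 2 ≤ f' * -l w * (m * ‖w‖) := by
    have hL := h.nonneg
    have hlw' : 0 ≤ -l w := by linarith
    calc L * f * ‖w‖ ^ 2 = L * f * ‖w‖ * ‖w‖ := by ring
      _ ≤ L * f * (K * -l w) * ‖w‖ := by gcongr
      _ = L * K / m * f * -l w * (m * ‖w‖) := by field_simp
      _ ≤ _ := by gcongr
  have h7 : 0 ≤ f' * -l w * (m * ‖w‖) :=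
    mul_nonneg (mul_nonneg hf'.le (by linarith)) (by positivity)
  linarith

end Cones

/-! ### Cone charts and the causal curves in them -/

namespace TimeOrientedLorentzMetric

variable {n : ℕ} {M : Type*} [TopologicalSpace M] [ChartedSpace (Rn n) M]
  [IsManifold 𝓘(ℝ, Rn n) ∞ M] (g : TimeOrientedLorentzMetric n M)

/-- A chart onto the unit ball in which the light cones of `g` form a cone field. -/
structure IsConeChart (φ : OpenPartialHomeomorph M (Rn n)) (e : Rn n) (l : Rn n →L[ℝ] ℝ)
    (K L m : ℝ) : Prop where
  mem : φ ∈ IsManifold.maximalAtlas 𝓘(ℝ, Rn n) ∞ M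
  target_eq : φ.target = Metric.ball 0 1
  cone : IsConeField (g.chartForm φ) (g.chartTime φ) φ.target e l K L m

variable {g} {φ : OpenPartialHomeomorph M (Rn n)} {e : Rn n} {l : Rn n →L[ℝ] ℝ} {K L m : ℝ}

theorem pastTimelike_subset_pastCausal (x : M) : g.pastTimelike x ⊆ g.pastCausal x :=
  fun v hv ↦ ⟨by rintro rfl; simp [pastTimelike] at hv, hv.1.le, hv.2⟩

namespace IsConeChart

theorem mem_target (hc : g.IsConeChart φ e l K L m) {y : Rn n} : y ∈ φ.target ↔ ‖y‖ < 1 := by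
  rw [hc.target_eq, mem_ball_zero_iff]

theorem pastTimelike_iff (hc : g.IsConeChart φ e l K L m) {y : Rn n} (hy : y ∈ φ.target)
    (w : Rn n) :
    chartDeriv φ y w ∈ g.pastTimelike (φ.symm y) ↔ g.chartForm φ y w w < 0 ∧ l w < 0 := by
  change g.chartForm φ y w w < 0 ∧ 0 < g.chartTime φ y w ↔ _
  refine and_congr_right fun h ↦ hc.cone.past_iff y hy w ?_ h.le
  rintro rfl
  simp at h

theorem pastCausal_imp (hc : g.IsConeChart φ e l K L m) {y : Rn n} (hy : y ∈ φ.target) {w : Rn n}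
    (h : chartDeriv φ y w ∈ g.pastCausal (φ.symm y)) : g.chartForm φ y w w ≤ 0 ∧ l w < 0 := by
  obtain ⟨h0, h1, h2⟩ := h
  refine ⟨h1, (hc.cone.past_iff y hy w ?_ h1).1 h2⟩
  rintro rfl
  exact h0 (map_zero _)

theorem axis_pastTimelike (hc : g.IsConeChart φ e l K L m) {y : Rn n} (hy : y ∈ φ.target)
    {s : ℝ} (hs : 0 < s) :
    chartDeriv φ y (-s • e) ∈ g.pastTimelike (φ.symm y) := by
  rw [hc.pastTimelike_iff hy]
  have h := hc.cone.axis_neg y hy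
  constructor
  · have : g.chartForm φ y (-s • e) (-s • e) = s ^ 2 * g.chartForm φ y e e := by simp; ring
    rw [this]
    exact mul_neg_of_pos_of_neg (by positivity) h
  · simpa [hc.cone.apply_axis] using hs

/-! ### Causal curves in a cone chart -/

/-- Right derivatives exist even at the breaks, which is all that one-sided mean value inequalities
need. -/
theorem exists_hasDerivWithinAt (hc : g.IsConeChart φ e l K L m) {γ : ℝ → M} {b : ℝ}
    (h : IsPiecewiseSmoothDirected g.pastCausal γ (Icc 0 b))
    (hγ : ∀ t ∈ Icc 0 b, γ t ∈ φ.source) {t : ℝ} (ht : t ∈ Ico 0 b) :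
    ∃ w, HasDerivWithinAt (fun t ↦ φ (γ t)) w (Ici t) t ∧
      g.chartForm φ (φ (γ t)) w w ≤ 0 ∧ l w < 0 := by
  obtain ⟨t', ht', hs⟩ := h.exists_right ht
  have hγ' : ∀ τ ∈ Icc t t', γ τ ∈ φ.source := fun τ hτ ↦
    hγ τ ⟨ht.1.trans hτ.1, hτ.2.trans ht'.2⟩
  have htt : t ∈ Icc t t' := ⟨le_rfl, ht'.1.le⟩
  refine ⟨derivWithin (fun t ↦ φ (γ t)) (Icc t t') t, ?_,
    hc.pastCausal_imp (φ.map_source (hγ' t htt)) (hs.chartDeriv_mem hc.mem ht'.1 hγ' htt)⟩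
  exact (((hs.contDiffOn_chart hc.mem hγ').differentiableOn (by simp) t htt).hasDerivWithinAt
    ).mono_of_mem_nhdsWithin (Icc_mem_nhdsGE ht'.1)

/-- Along a causal curve the displacement is controlled by the drop of the time function. -/
theorem norm_sub_le (hc : g.IsConeChart φ e l K L m) {γ : ℝ → M} {a b : ℝ}
    (h : IsPiecewiseSmoothDirected g.pastCausal γ (Icc 0 b))
    (hγ : ∀ t ∈ Icc 0 b, γ t ∈ φ.source) (ha : 0 ≤ a) (hab : a ≤ b) :
    ‖φ (γ b) - φ (γ a)‖ ≤ K * (l (φ (γ a)) - l (φ (γ b))) := by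
  have hcont : ContinuousOn (fun t ↦ φ (γ t)) (Icc a b) :=
    (φ.continuousOn.comp h.continuousOn hγ).mono (Icc_subset_Icc ha le_rfl)
  have hd : ∀ t ∈ Ico a b, ∃ w, HasDerivWithinAt (fun t ↦ φ (γ t)) w (Ici t) t ∧
      g.chartForm φ (φ (γ t)) w w ≤ 0 ∧ l w < 0 := fun t ht ↦
    hc.exists_hasDerivWithinAt h hγ ⟨ha.trans ht.1, ht.2⟩
  choose! w hw hw1 hw2 using hd
  -- The right derivative `w` of the curve satisfies `‖w‖ ≤ K * -l w`, and the right-hand side is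
  -- the derivative of the bound.
  refine image_norm_le_of_norm_deriv_right_le_deriv_boundary' (a := a) (b := b)
    (f := fun t ↦ φ (γ t) - φ (γ a)) (f' := w)
    (B := fun t ↦ K * (l (φ (γ a)) - l (φ (γ t)))) (B' := fun t ↦ K * -l (w t))
    (hcont.sub continuousOn_const) (fun t ht ↦ (hw t ht).sub_const _) (by simp)
    (continuousOn_const.mul (continuousOn_const.sub (l.continuous.comp_continuousOn hcont)))
    (fun t ht ↦ ?_) (fun t ht ↦ ?_) ⟨hab, le_rfl⟩
  · exact ((l.hasFDerivAt.comp_hasDerivWithinAt t (hw t ht)).const_sub _).const_mul K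
  · have := hc.cone.norm_le _ (φ.map_source (hγ t ⟨ha.trans ht.1, ht.2.le⟩)) _ (hw1 t ht)
    rwa [abs_of_neg (hw2 t ht)] at this

theorem apply_le (hc : g.IsConeChart φ e l K L m) {γ : ℝ → M} {a b : ℝ}
    (h : IsPiecewiseSmoothDirected g.pastCausal γ (Icc 0 b))
    (hγ : ∀ t ∈ Icc 0 b, γ t ∈ φ.source) (ha : 0 ≤ a) (hab : a ≤ b) :
    l (φ (γ b)) ≤ l (φ (γ a)) := by
  have h1 := (norm_nonneg _).trans (hc.norm_sub_le h hγ ha hab)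
  have h2 : 0 < K := zero_lt_one.trans_le hc.cone.one_le
  have := nonneg_of_mul_nonneg_right h1 h2
  linarith

/-- If the endpoint values agreed, monotonicity would make `l` constant along the curve, against its
negative right derivative at the start. -/
theorem apply_lt_of_mem_chronPast (hc : g.IsConeChart φ e l K L m) {x q : M}
    (h : x ∈ g.chronPast φ.source q) : l (φ x) < l (φ q) := by
  obtain ⟨γ, hγ, hU, rfl, rfl⟩ := h
  have hγ' : IsPiecewiseSmoothDirected g.pastCausal γ (Icc 0 1) := by
    obtain ⟨P, hP, h⟩ := hγ
    exact ⟨P, hP, fun a b hab hs hd ↦ ⟨(h a b hab hs hd).1, fun t ht ↦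
      pastTimelike_subset_pastCausal _ ((h a b hab hs hd).2 t ht)⟩⟩
  refine lt_of_le_of_ne (hc.apply_le hγ' hU le_rfl zero_le_one) fun heq ↦ ?_
  have hconst : ∀ t ∈ Icc (0 : ℝ) 1, l (φ (γ t)) = l (φ (γ 0)) := fun t ht ↦ by
    have h1 := hc.apply_le (hγ'.mono (Icc_subset_Icc le_rfl ht.2))
      (fun τ hτ ↦ hU τ ⟨hτ.1, hτ.2.trans ht.2⟩) le_rfl ht.1
    have h2 := hc.apply_le hγ' hU ht.1 ht.2
    linarith
  obtain ⟨w, hw, -, hw2⟩ := hc.exists_hasDerivWithinAt hγ' hU (t := 0) ⟨le_rfl, zero_lt_one⟩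
  have hd := l.hasFDerivAt.comp_hasDerivWithinAt (0 : ℝ) hw
  have hd' : HasDerivWithinAt (l ∘ fun t ↦ φ (γ t)) 0 (Ici 0) 0 := by
    refine (hasDerivWithinAt_const (0 : ℝ) (Ici 0) (l (φ (γ 0)))).congr_of_eventuallyEq ?_ rfl
    filter_upwards [Icc_mem_nhdsGE (zero_lt_one' ℝ)] with t ht using hconst t ht
  exact hw2.ne ((uniqueDiffWithinAt_Ici (0 : ℝ)).eq_deriv _ hd hd')

/-- Segments along the axis are timelike. -/
theorem isSmoothDirected_segment (hc : g.IsConeChart φ e l K L m) {y : Rn n} {s a b : ℝ}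
    (hs : 0 < s) (hab : a < b) (hy : ∀ t ∈ Icc a b, y - (t * s) • e ∈ φ.target) :
    IsSmoothDirected g.pastTimelike (fun t ↦ φ.symm (y - (t * s) • e)) a b := by
  refine (isSmoothDirected_chart hc.mem hab (by fun_prop) hy).2 fun t ht ↦ ?_
  have hd : HasDerivAt (fun t : ℝ ↦ y - (t * s) • e) (-s • e) t := by
    simpa using (((hasDerivAt_id t).mul_const s).smul_const e).const_sub y
  rw [hd.hasDerivWithinAt.derivWithin (uniqueDiffOn_Icc hab t ht)]
  exact hc.axis_pastTimelike (hy t ht) hs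

theorem segment_mem_target (hc : g.IsConeChart φ e l K L m) {y : Rn n} {s : ℝ}
    (hy : y ∈ φ.target) (hy' : y - s • e ∈ φ.target) {t : ℝ} (ht : t ∈ Icc (0 : ℝ) 1) :
    y - (t * s) • e ∈ φ.target := by
  rw [hc.target_eq] at hy hy' ⊢
  have h := (convex_ball (0 : Rn n) 1) hy hy' (sub_nonneg.2 ht.2) ht.1 (by ring)
  convert h using 1
  module

theorem segment_mem_chronPast (hc : g.IsConeChart φ e l K L m) {y : Rn n} {s : ℝ} (hs : 0 < s)
    (hy : y ∈ φ.target) (hy' : y - s • e ∈ φ.target) :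
    φ.symm (y - s • e) ∈ g.chronPast φ.source (φ.symm y) := by
  have hmem := fun t ht ↦ hc.segment_mem_target hy hy' (t := t) ht
  refine ⟨fun t ↦ φ.symm (y - (t * s) • e), ⟨∅, by simp, fun a b hab hsub _ ↦ ?_⟩,
    fun t ht ↦ φ.map_target (hmem t ht), by simp, by simp⟩
  exact hc.isSmoothDirected_segment hs hab fun t ht ↦ hmem t (hsub ht)

/-- A point on the hyperplane `l = c` reached by a causal curve from `x` lies in the chronological
past of every point slightly above `x`. -/
theorem mem_chronPast_of_causal (hc : g.IsConeChart φ e l K L m) {γ : ℝ → M} {b c s : ℝ}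
    (hb : 0 < b) (h : IsPiecewiseSmoothDirected g.pastCausal γ (Icc 0 b))
    (hγ : ∀ t ∈ Icc 0 b, γ t ∈ φ.source) (hnorm : ∀ t ∈ Icc 0 b, ‖φ (γ t)‖ + s < 1) (hs : 0 < s)
    (h0 : c < l (φ (γ 0))) (h1 : l (φ (γ b)) = c) :
    γ b ∈ g.chronPast φ.source (φ.symm (φ (γ 0) + s • e)) := by
  -- With `F τ = A * (exp (k * τ) - exp (k * c))` one has `F' = k * (F + A * exp (k * c))`. This
  -- dominates `L * K / m * F`, as `shear_neg` requires, and is positive even where `F` vanishes;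
  -- the summand `1` covers the case `L = 0`.
  set k := L * K / m + 1 with hk
  have hK : 0 < K := zero_lt_one.trans_le hc.cone.one_le
  have hLK : 0 ≤ L * K / m := div_nonneg (mul_nonneg hc.cone.nonneg hK.le) hc.cone.pos.le
  have hk0 : 0 < k := by linarith
  -- Normalised so that the shift equals `s` at the start of the curve; it vanishes at level `c`, so
  -- the endpoint stays fixed.
  set A := s / (Real.exp (k * l (φ (γ 0))) - Real.exp (k * c)) with hA
  have hden : 0 < Real.exp (k * l (φ (γ 0))) - Real.exp (k * c) :=
    sub_pos.2 (Real.exp_lt_exp.2 (mul_lt_mul_of_pos_left h0 hk0))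
  have hA0 : 0 < A := div_pos hs hden
  set F : ℝ → ℝ := fun τ ↦ A * (Real.exp (k * τ) - Real.exp (k * c)) with hF
  have hF0 : F (l (φ (γ 0))) = s := div_mul_cancel₀ _ hden.ne'
  have hFc : F c = 0 := by simp [hF]
  have hFmono : Monotone F := fun τ τ' hτ ↦ by
    simp only [hF]
    gcongr
  have hFd : ∀ τ, HasDerivAt F (k * (F τ + A * Real.exp (k * c))) τ := fun τ ↦ by
    have hd := (((((hasDerivAt_id τ).const_mul k).exp).sub_const (Real.exp (k * c))).const_mul A)
    refine HasDerivAt.congr_deriv (f := F) hd ?_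
    change A * (Real.exp (k * τ) * (k * 1)) =
      k * (A * (Real.exp (k * τ) - Real.exp (k * c)) + A * Real.exp (k * c))
    ring
  have hFs : ContDiff ℝ ∞ F := by fun_prop
  have hrange : ∀ t ∈ Icc 0 b, 0 ≤ F (l (φ (γ t))) ∧ F (l (φ (γ t))) ≤ s := fun t ht ↦ by
    have e1 := hc.apply_le h hγ ht.1 ht.2
    have e2 := hc.apply_le (h.mono (Icc_subset_Icc le_rfl ht.2))
      (fun τ hτ ↦ hγ τ ⟨hτ.1, hτ.2.trans ht.2⟩) le_rfl ht.1
    exact ⟨hFc ▸ h1 ▸ hFmono e1, hF0 ▸ hFmono e2⟩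
  have htarget : ∀ t ∈ Icc 0 b, φ (γ t) + F (l (φ (γ t))) • e ∈ φ.target := fun t ht ↦ by
    rw [hc.mem_target]
    refine (norm_add_le _ _).trans_lt ?_
    rw [norm_smul, hc.cone.norm_axis, mul_one, Real.norm_of_nonneg (hrange t ht).1]
    linarith [hnorm t ht, (hrange t ht).2]
  refine g.mem_chronPast_of_curve (γ := fun t ↦ φ.symm (φ (γ t) + F (l (φ (γ t))) • e)) hb ?_
    (fun t ht ↦ φ.map_target (htarget t ht)) (by simp only [hF0]) ?_
  · obtain ⟨P, hP, hpiece⟩ := h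
    refine ⟨P, hP, fun a a' haa hsub hd ↦ ?_⟩
    have hp : IsSmoothDirected g.pastCausal γ a a' := hpiece a a' haa hsub hd
    have hγa : ∀ t ∈ Icc a a', γ t ∈ φ.source := fun t ht ↦ hγ t (hsub ht)
    have hx := hp.contDiffOn_chart hc.mem hγa
    have hlx : ContDiffOn ℝ ∞ (fun t ↦ l (φ (γ t))) (Icc a a') := l.contDiff.comp_contDiffOn hx
    set x : ℝ → Rn n := fun t ↦ φ (γ t) + F (l (φ (γ t))) • e with hxdef
    have hxs : ContDiffOn ℝ ∞ x (Icc a a') :=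
      hx.add ((hFs.comp_contDiffOn hlx).smul contDiffOn_const)
    refine (isSmoothDirected_chart hc.mem haa hxs fun t ht ↦ htarget t (hsub ht)).2 fun t ht ↦ ?_
    have hw := hc.pastCausal_imp (φ.map_source (hγa t ht)) (hp.chartDeriv_mem hc.mem haa hγa ht)
    have hxd := (hx.differentiableOn (by simp) t ht).hasDerivWithinAt
    set w := derivWithin (fun t ↦ φ (γ t)) (Icc a a') t with hwdef
    have hd := hxd.add ((((hFd _).comp_hasDerivWithinAt t
      (l.hasFDerivAt.comp_hasDerivWithinAt t hxd)).smul_const e))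
    have hd' : derivWithin x (Icc a a') t =
        w + (k * (F (l (φ (γ t))) + A * Real.exp (k * c)) * l w) • e :=
      hd.derivWithin (uniqueDiffOn_Icc haa t ht)
    have hAexp : 0 < A * Real.exp (k * c) := by positivity
    have hFt := (hrange t (hsub ht)).1
    have hsh := hc.cone.shear_neg (φ.map_source (hγa t ht)) (htarget t (hsub ht)) hFt
      (f' := k * (F (l (φ (γ t))) + A * Real.exp (k * c))) (by positivity) (by
        calc L * K / m * F (l (φ (γ t))) ≤ k * F (l (φ (γ t))) :=
              mul_le_mul_of_nonneg_right (by linarith) hFt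
          _ ≤ _ := by gcongr; linarith) hw.1 hw.2
    rw [hd']
    exact (hc.pastTimelike_iff (htarget t (hsub ht)) _).2 hsh
  · simp only [h1, hFc, zero_smul, add_zero]
    exact φ.left_inv (hγ b ⟨hb.le, le_rfl⟩)

end IsConeChart

end TimeOrientedLorentzMetric

namespace TimeOrientedLorentzMetric

variable {n : ℕ} {M : Type*} [TopologicalSpace M] [ChartedSpace (Rn n) M]
  [IsManifold 𝓘(ℝ, Rn n) ∞ M] {g : TimeOrientedLorentzMetric n M}

/-! ### Parameter rays -/

theorem Icc_subset_rayDomain {b : EReal} {t : ℝ} (ht : t ∈ rayDomain b) :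
    Icc 0 t ⊆ rayDomain b := fun _ hτ ↦
  ⟨hτ.1, (EReal.coe_le_coe_iff.2 hτ.2).trans_lt ht.2⟩

theorem zero_mem_rayDomain {b : EReal} (hb : 0 < b) : (0 : ℝ) ∈ rayDomain b :=
  ⟨le_rfl, by simpa using hb⟩

theorem rayDomain_mono {b b' : EReal} (h : b ≤ b') : rayDomain b ⊆ rayDomain b' :=
  fun _ ht ↦ ⟨ht.1, ht.2.trans_le h⟩

theorem coe_add_one_lt_add_one_iff {b : EReal} {t : ℝ} :
    ((t + 1 : ℝ) : EReal) < b + 1 ↔ (t : EReal) < b := by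
  induction b with
  | bot => simp
  | top =>
    rw [EReal.top_add_of_ne_bot (by exact_mod_cast EReal.coe_ne_bot 1)]
    exact ⟨fun _ ↦ EReal.coe_lt_top t, fun _ ↦ EReal.coe_lt_top _⟩
  | coe b =>
    rw [← EReal.coe_one, ← EReal.coe_add, EReal.coe_lt_coe_iff, EReal.coe_lt_coe_iff]
    exact add_lt_add_iff_right 1

/-- A curve without endpoint in `M`, cut off where it leaves the open set `U`, has no endpoint
in `U`. -/
theorem exists_truncation [T2Space M] {U : Set M} (hU : IsOpen U) {γ : ℝ → M} {b : EReal}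
    (hb : 0 < b) (hγ : ContinuousOn γ (rayDomain b)) (h0 : γ 0 ∈ U)
    (hend : ∀ q, ¬ IsEndpoint γ b q) :
    ∃ b' ≤ b, 0 < b' ∧ (∀ t ∈ rayDomain b', γ t ∈ U) ∧ ∀ q ∈ U, ¬ IsEndpoint γ b' q := by
  by_cases hA : ∀ t ∈ rayDomain b, γ t ∈ U
  · exact ⟨b, le_rfl, hb, hA, fun q _ ↦ hend q⟩
  push Not at hA
  obtain ⟨t₁, ht₁, ht₁U⟩ := hA
  set A := {t ∈ rayDomain b | γ t ∉ U} with hAdef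
  have hAne : A.Nonempty := ⟨t₁, ht₁, ht₁U⟩
  have hAbdd : BddBelow A := ⟨0, fun t ht ↦ ht.1.1⟩
  -- `T` is the first exit time, and `γ T ∉ U` because `U` is open. By the Hausdorff property the
  -- curve cut off at `T` can only end at `γ T`.
  set T := sInf A with hT
  have hT0 : 0 ≤ T := le_csInf hAne fun t ht ↦ ht.1.1
  have hTb : T ∈ rayDomain b := Icc_subset_rayDomain ht₁ ⟨hT0, csInf_le hAbdd ⟨ht₁, ht₁U⟩⟩
  have hTU : γ T ∉ U := by
    intro hmem
    have hnear := (hγ T hTb).eventually (hU.mem_nhds hmem)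
    rw [eventually_nhdsWithin_iff, Metric.eventually_nhds_iff] at hnear
    obtain ⟨ε, hε, hnear⟩ := hnear
    obtain ⟨t, htA, htε⟩ := exists_lt_of_csInf_lt hAne (lt_add_of_pos_right T hε)
    have htT : T ≤ t := csInf_le hAbdd htA
    exact htA.2 (hnear (by rw [Real.dist_eq, abs_lt]; constructor <;> linarith) htA.1)
  have hTpos : 0 < T := hT0.lt_of_ne fun h ↦ hTU (h ▸ h0)
  have hray : ∀ {t : ℝ}, t ∈ rayDomain (T : EReal) ↔ 0 ≤ t ∧ t < T := fun {t} ↦ by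
    simp [rayDomain]
  refine ⟨T, hTb.2.le, by exact_mod_cast hTpos, fun t ht ↦ ?_, fun q hq hE ↦ ?_⟩
  · rw [hray] at ht
    by_contra htU
    exact (csInf_le hAbdd ⟨Icc_subset_rayDomain hTb ⟨ht.1, ht.2.le⟩, htU⟩).not_gt ht.2
  · have hne : q ≠ γ T := fun h ↦ hTU (h ▸ hq)
    obtain ⟨V, W, hV, hW, hqV, hTW, hd⟩ := t2_separation hne
    obtain ⟨t₀, ht₀, hVt⟩ := hE V (hV.mem_nhds hqV)
    have hnear := (hγ T hTb).eventually (hW.mem_nhds hTW)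
    rw [eventually_nhdsWithin_iff, Metric.eventually_nhds_iff] at hnear
    obtain ⟨ε, hε, hnear⟩ := hnear
    rw [hray] at ht₀
    obtain ⟨t, ht, htT⟩ := exists_between (max_lt ht₀.2 (sub_lt_self T hε))
    have h1 : t₀ < t := (le_max_left _ _).trans_lt ht
    have h2 : T - ε < t := (le_max_right _ _).trans_lt ht
    have h3 : 0 ≤ t := ht₀.1.trans h1.le
    exact disjoint_left.1 hd (hVt t (hray.2 ⟨h3, htT⟩) h1.le)
      (hnear (by rw [Real.dist_eq, abs_lt]; constructor <;> linarith)
        (Icc_subset_rayDomain hTb ⟨h3, htT.le⟩))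

/-- The curve which follows `γ₁` on `[0, 1]` and then `γ₂`. -/
def concat (γ₁ γ₂ : ℝ → M) (t : ℝ) : M := if t ≤ 1 then γ₁ t else γ₂ (t - 1)

theorem concat_of_le {γ₁ γ₂ : ℝ → M} {t : ℝ} (ht : t ≤ 1) : concat γ₁ γ₂ t = γ₁ t := if_pos ht

theorem concat_of_ge {γ₁ γ₂ : ℝ → M} (h : γ₁ 1 = γ₂ 0) {t : ℝ} (ht : 1 ≤ t) :
    concat γ₁ γ₂ t = γ₂ (t - 1) := by
  rcases ht.eq_or_lt with rfl | ht
  · simp [concat, h]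
  · exact if_neg ht.not_ge

/-- Both parts are smooth, so the junction at `1` is the only break, and an endpoint of the whole
curve would be one of `γ₂`. -/
theorem isPastInextendibleCausal_concat {U : Set M} {γ₁ γ₂ : ℝ → M} {b : EReal} (hb : 0 < b)
    (h : γ₁ 1 = γ₂ 0) (hU₁ : ∀ t ∈ Icc (0 : ℝ) 1, γ₁ t ∈ U) (hU₂ : ∀ t ∈ rayDomain b, γ₂ t ∈ U)
    (h₁ : ∀ a b, a < b → Icc a b ⊆ Icc (0 : ℝ) 1 → IsSmoothDirected g.pastCausal γ₁ a b)
    (h₂ : ∀ a a', a < a' → Icc a a' ⊆ rayDomain b → IsSmoothDirected g.pastCausal γ₂ a a')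
    (hend : ∀ q ∈ U, ¬ IsEndpoint γ₂ b q) :
    g.IsPastInextendibleCausal U (γ₁ 0) (concat γ₁ γ₂) (b + 1) := by
  have hshift : ∀ {t : ℝ}, 1 ≤ t → t ∈ rayDomain (b + 1) → t - 1 ∈ rayDomain b := by
    intro t ht htb
    refine ⟨by linarith, coe_add_one_lt_add_one_iff.1 ?_⟩
    rw [sub_add_cancel]
    exact htb.2
  refine ⟨by positivity, ⟨{1}, fun t _ ↦ (finite_singleton 1).subset inter_subset_left,
    fun a a' haa hsub hd ↦ ?_⟩, fun t ht ↦ ?_, concat_of_le zero_le_one, fun q hq hE ↦ ?_⟩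
  · have ha := hsub ⟨le_rfl, haa.le⟩
    have ha' := hsub ⟨haa.le, le_rfl⟩
    rcases le_or_gt a' 1 with h1 | h1
    · exact (h₁ a a' haa (Icc_subset_Icc ha.1 h1)).congr fun t ht ↦ concat_of_le (ht.2.trans h1)
    · have h1a : 1 ≤ a := by
        by_contra! hlt
        exact disjoint_left.1 hd ⟨hlt, h1⟩ rfl
      have hs : IsSmoothDirected g.pastCausal γ₂ (a - 1) (a' - 1) :=
        h₂ _ _ (by linarith) fun t ht ↦ Icc_subset_rayDomain (hshift h1.le ha')
          ⟨by linarith [ht.1], ht.2⟩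
      refine IsSmoothDirected.congr (γ := fun t ↦ γ₂ (1 * t + -1))
        (hs.comp_affine one_pos haa (by ring) (by ring) fun x v hv ↦ by rwa [one_smul])
        fun t ht ↦ ?_
      simp only [concat_of_ge h (h1a.trans ht.1), one_mul, sub_eq_add_neg]
  · rcases le_total t 1 with h1 | h1
    · rw [concat_of_le h1]
      exact hU₁ t ⟨ht.1, h1⟩
    · rw [concat_of_ge h h1]
      exact hU₂ _ (hshift h1 ht)
  · refine hend q hq fun V hV ↦ ?_
    obtain ⟨t₀, ht₀, hVt⟩ := hE V hV
    -- The parameter `t₀` may lie before the junction.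
    refine ⟨max (t₀ - 1) 0, ?_, fun t ht ht' ↦ ?_⟩
    · rcases le_total t₀ 1 with h1 | h1
      · rw [max_eq_right (by linarith)]
        exact zero_mem_rayDomain hb
      · rw [max_eq_left (by linarith)]
        exact hshift h1 ht₀
    · have := hVt (t + 1) ⟨by linarith [ht.1], coe_add_one_lt_add_one_iff.2 ht.2⟩
        (by linarith [(le_max_left _ _).trans ht'])
      rwa [concat_of_ge h (by linarith [ht.1]), add_sub_cancel_right] at this

namespace IsConeChart

variable {φ : OpenPartialHomeomorph M (Rn n)} {e : Rn n} {l : Rn n →L[ℝ] ℝ} {K L m : ℝ}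

/-- A past inextendible causal curve which starts close enough above the hyperplane `l = c`
meets it. -/
theorem exists_apply_eq (hc : g.IsConeChart φ e l K L m) {z : M} {γ : ℝ → M} {b : EReal}
    (h : g.IsPastInextendibleCausal φ.source z γ b) {c R : ℝ} (hR : R < 1) (hz : c < l (φ z))
    (hzR : ‖φ z‖ + K * (l (φ z) - c) ≤ R) :
    ∃ T ∈ rayDomain b, 0 < T ∧ l (φ (γ T)) = c ∧ ∀ t ∈ Icc 0 T, ‖φ (γ t)‖ ≤ R := by
  obtain ⟨hb, hp, hU, rfl, hend⟩ := h
  have hK : 0 < K := zero_lt_one.trans_le hc.cone.one_le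
  have hpT : ∀ {T}, T ∈ rayDomain b → IsPiecewiseSmoothDirected g.pastCausal γ (Icc 0 T) :=
    fun hT ↦ hp.mono (Icc_subset_rayDomain hT)
  have hUT : ∀ {T}, T ∈ rayDomain b → ∀ t ∈ Icc 0 T, γ t ∈ φ.source :=
    fun hT t ht ↦ hU t (Icc_subset_rayDomain hT ht)
  have hbound : ∀ t ∈ rayDomain b, c ≤ l (φ (γ t)) → ‖φ (γ t)‖ ≤ R := by
    intro t ht hct
    have h1 := hc.norm_sub_le (hpT ht) (hUT ht) le_rfl ht.1
    have h2 : ‖φ (γ t)‖ ≤ ‖φ (γ 0)‖ + ‖φ (γ t) - φ (γ 0)‖ := by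
      simpa using norm_add_le (φ (γ 0)) (φ (γ t) - φ (γ 0))
    have h3 : K * (l (φ (γ 0)) - l (φ (γ t))) ≤ K * (l (φ (γ 0)) - c) := by gcongr
    linarith
  by_cases hex : ∃ T ∈ rayDomain b, l (φ (γ T)) ≤ c
  · obtain ⟨T₁, hT₁, hle⟩ := hex
    have hcont : ContinuousOn (fun t ↦ l (φ (γ t))) (Icc 0 T₁) :=
      l.continuous.comp_continuousOn (φ.continuousOn.comp (hpT hT₁).continuousOn (hUT hT₁))
    obtain ⟨T, hT, hTc⟩ := intermediate_value_Icc' hT₁.1 hcont ⟨hle, hz.le⟩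
    have hTb := Icc_subset_rayDomain hT₁ hT
    refine ⟨T, hTb, hT.1.lt_of_ne ?_, hTc, fun t ht ↦ ?_⟩
    · rintro rfl
      exact hz.ne' hTc
    · exact hbound t (Icc_subset_rayDomain hTb ht)
        (hTc ▸ hc.apply_le (hpT hTb) (hUT hTb) ht.1 ht.2)
  -- If the curve stays above level `c`, then `l` decreases to a limit along it, so the displacement
  -- bound makes the curve Cauchy in the chart. Its limit has norm at most `R < 1` and would be an
  -- endpoint inside the chart.
  · exfalso
    push Not at hex
    have : Nonempty (rayDomain b) := ⟨⟨0, zero_mem_rayDomain hb⟩⟩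
    set u : rayDomain b → ℝ := fun t ↦ l (φ (γ t)) with hu
    set x : rayDomain b → Rn n := fun t ↦ φ (γ t) with hx
    have hanti : Antitone u := fun s t hst ↦
      hc.apply_le (hpT t.2) (hUT t.2) s.2.1 hst
    have hbdd : BddBelow (range u) := ⟨c, by rintro _ ⟨t, rfl⟩; exact (hex t t.2).le⟩
    have hcau : CauchySeq x := by
      rw [Metric.cauchySeq_iff']
      intro ε hε
      obtain ⟨N, hN⟩ := exists_lt_of_ciInf_lt (lt_add_of_pos_right (⨅ t, u t) (div_pos hε hK))
      refine ⟨N, fun t ht ↦ ?_⟩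
      rw [dist_eq_norm]
      refine (hc.norm_sub_le (hpT t.2) (hUT t.2) N.2.1 ht).trans_lt ?_
      have h1 : (⨅ t, u t) ≤ u t := ciInf_le hbdd t
      have h2 : u N - u t < ε / K := by linarith
      rwa [lt_div_iff₀' hK] at h2
    obtain ⟨xs, hxs⟩ := cauchySeq_tendsto_of_complete hcau
    have hxsR : ‖xs‖ ≤ R := le_of_tendsto hxs.norm
      (Eventually.of_forall fun t ↦ hbound t t.2 (hex t t.2).le)
    have hxst : xs ∈ φ.target := hc.mem_target.2 (hxsR.trans_lt hR)
    have hlim : Tendsto (fun t : rayDomain b ↦ γ t) atTop (𝓝 (φ.symm xs)) := by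
      refine ((φ.continuousAt_symm hxst).tendsto.comp hxs).congr fun t ↦ ?_
      exact φ.left_inv (hU t t.2)
    refine hend _ (φ.map_target hxst) fun V hV ↦ ?_
    obtain ⟨N, hN⟩ := eventually_atTop.1 (hlim.eventually hV)
    exact ⟨N, N.2, fun t ht hNt ↦ hN ⟨t, ht⟩ hNt⟩

end IsConeChart

end TimeOrientedLorentzMetric

/-! ### Sign changes along parallel lines -/

/-- A continuous function on a ball which vanishes at most once on each line in direction `e` and
takes both signs near the centre changes sign along the lines in direction `e` near the centre. -/
theorem exists_sign_change {E : Type*} [NormedAddCommGroup E] [NormedSpace ℝ E] {e : E}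
    (he : ‖e‖ = 1) {h : E → ℝ} {r : ℝ} (hcont : ContinuousOn h (Metric.ball 0 r)) (h0 : h 0 = 0)
    (hinj : ∀ y ∈ Metric.ball (0 : E) r, ∀ s > (0 : ℝ), y - s • e ∈ Metric.ball (0 : E) r →
      ¬ (h y = 0 ∧ h (y - s • e) = 0))
    (hpos : ∃ᶠ y in 𝓝 0, 0 < h y) (hneg : ∃ᶠ y in 𝓝 0, h y < 0) {δ : ℝ} (hδ : 0 < δ)
    (hδr : δ < r) :
    ∃ σ : ℝ, σ ≠ 0 ∧ ∀ᶠ y in 𝓝 (0 : E), σ * h (y - δ • e) < 0 ∧ 0 < σ * h (y + δ • e) := by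
  have hball : ∀ t : ℝ, |t| ≤ δ → ∀ᶠ y in 𝓝 (0 : E), y + t • e ∈ Metric.ball (0 : E) r := by
    intro t ht
    filter_upwards [Metric.ball_mem_nhds (0 : E) (sub_pos.2 hδr)] with y hy
    rw [mem_ball_zero_iff] at hy ⊢
    refine (norm_add_le _ _).trans_lt ?_
    rw [norm_smul, he, mul_one, Real.norm_eq_abs]
    linarith
  have hr : 0 < r := hδ.trans hδr
  have hat : ∀ t : ℝ, |t| ≤ δ → ContinuousAt (fun y ↦ h (y + t • e)) 0 := by
    intro t ht
    refine ContinuousAt.comp_of_eq (y := t • e) (hcont.continuousAt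
      (Metric.isOpen_ball.mem_nhds ?_)) (by fun_prop) (by simp)
    simpa using (hball t ht).self_of_nhds
  have hδa : |δ| ≤ δ := (abs_of_pos hδ).le
  have hδa' : |-δ| ≤ δ := by rw [abs_neg]; exact hδa
  have hup : h (δ • e) ≠ 0 := fun hz ↦ hinj (δ • e)
    (by simpa using (hball δ hδa).self_of_nhds) δ hδ (by simpa using hr) ⟨hz, by simpa using h0⟩
  have hdown : h (-δ • e) ≠ 0 := fun hz ↦ hinj 0 (by simpa using hr) δ hδ
    (by simpa using (hball (-δ) hδa').self_of_nhds) ⟨h0, by simpa using hz⟩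
  -- If `h` had the same sign at `δ • e` and `-δ • e`, this would persist on nearby parallel lines.
  -- A nearby point of the opposite sign would then lie between two zeros on its line.
  have key : ∀ σ : ℝ, σ ≠ 0 → 0 < σ * h (δ • e) → (∃ᶠ y in 𝓝 0, σ * h y < 0) →
      σ * h (-δ • e) < 0 := by
    intro σ hσ hσup hfreq
    by_contra hcon
    have hσdown : 0 < σ * h (-δ • e) := lt_of_le_of_ne (not_lt.1 hcon)
      (mul_ne_zero hσ hdown).symm
    have e1 : ∀ᶠ y in 𝓝 (0 : E), 0 < σ * h (y + δ • e) :=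
      ((hat δ hδa).const_mul σ).eventually (lt_mem_nhds (by simpa using hσup))
    have e2 : ∀ᶠ y in 𝓝 (0 : E), 0 < σ * h (y + -δ • e) :=
      ((hat (-δ) hδa').const_mul σ).eventually (lt_mem_nhds (by simpa using hσdown))
    obtain ⟨y, hy, y1, y2, b1⟩ := (hfreq.and_eventually (e1.and (e2.and
      (Metric.ball_mem_nhds (0 : E) (sub_pos.2 hδr))))).exists
    have hline : ∀ t ∈ Icc (-δ) δ, y + t • e ∈ Metric.ball (0 : E) r := by
      intro t ht
      rw [dist_zero_right] at b1
      rw [mem_ball_zero_iff]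
      refine (norm_add_le _ _).trans_lt ?_
      rw [norm_smul, he, mul_one, Real.norm_eq_abs]
      linarith [abs_le.2 ht]
    have hc : ContinuousOn (fun t : ℝ ↦ σ * h (y + t • e)) (Icc (-δ) δ) :=
      continuousOn_const.mul (hcont.comp (by fun_prop) hline)
    obtain ⟨t₁, ht₁, hz₁⟩ := intermediate_value_Ioo' (neg_lt_zero.2 hδ).le
      (hc.mono (Icc_subset_Icc le_rfl hδ.le)) (show (0 : ℝ) ∈ Ioo _ _ from ⟨by simpa using hy, y2⟩)
    obtain ⟨t₂, ht₂, hz₂⟩ := intermediate_value_Ioo hδ.le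
      (hc.mono (Icc_subset_Icc (neg_lt_zero.2 hδ).le le_rfl))
      (show (0 : ℝ) ∈ Ioo _ _ from ⟨by simpa using hy, y1⟩)
    have hsub : y + t₂ • e - (t₂ - t₁) • e = y + t₁ • e := by module
    refine hinj (y + t₂ • e) (hline t₂ ⟨by linarith [ht₂.1], ht₂.2.le⟩) (t₂ - t₁)
      (by linarith [ht₁.2, ht₂.1]) ?_ ⟨(mul_eq_zero.1 hz₂).resolve_left hσ, ?_⟩
    · rw [hsub]
      exact hline t₁ ⟨ht₁.1.le, by linarith [ht₁.2]⟩
    · rw [hsub]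
      exact (mul_eq_zero.1 hz₁).resolve_left hσ
  obtain ⟨σ, hσ, h1, h2⟩ : ∃ σ : ℝ, σ ≠ 0 ∧ 0 < σ * h (δ • e) ∧ σ * h (-δ • e) < 0 := by
    rcases hup.lt_or_gt with hlt | hgt
    · exact ⟨-1, by simp, by linarith, key (-1) (by simp) (by linarith)
        (hpos.mono fun y hy ↦ by linarith)⟩
    · exact ⟨1, by simp, by linarith, key 1 (by simp) (by linarith)
        (hneg.mono fun y hy ↦ by linarith)⟩
  refine ⟨σ, hσ, ?_⟩
  have e1 : ∀ᶠ y in 𝓝 (0 : E), 0 < σ * h (y + δ • e) :=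
    ((hat δ hδa).const_mul σ).eventually (lt_mem_nhds (by simpa using h1))
  have e2 : ∀ᶠ y in 𝓝 (0 : E), σ * h (y + -δ • e) < 0 :=
    ((hat (-δ) hδa').const_mul σ).eventually (gt_mem_nhds (by simpa using h2))
  filter_upwards [e1, e2] with y y1 y2
  exact ⟨by rwa [sub_eq_add_neg, ← neg_smul], y1⟩

namespace TimeOrientedLorentzMetric

variable {n : ℕ} {M : Type*} [TopologicalSpace M] [ChartedSpace (Rn n) M]
  [IsManifold 𝓘(ℝ, Rn n) ∞ M] {g : TimeOrientedLorentzMetric n M}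

variable {φ : OpenPartialHomeomorph M (Rn n)} {e : Rn n} {l : Rn n →L[ℝ] ℝ} {K L m : ℝ}

/-! ### Horizons in a cone chart -/

/-- The open cylinder of radius `ρ` and height `2δ` around the axis `e`. -/
def cylinder (e : Rn n) (l : Rn n →L[ℝ] ℝ) (ρ δ : ℝ) : Set (Rn n) :=
  {y | ‖y - l y • e‖ < ρ ∧ |l y| < δ}

theorem isOpen_cylinder (ρ δ : ℝ) : IsOpen (cylinder e l ρ δ) :=
  IsOpen.and (isOpen_lt (f := fun y : Rn n ↦ ‖y - l y • e‖) (by fun_prop) continuous_const)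
    (isOpen_lt (f := fun y : Rn n ↦ |l y|) (by fun_prop) continuous_const)

namespace IsConeChart

theorem norm_lt_of_mem_cylinder (hc : g.IsConeChart φ e l K L m) {ρ δ : ℝ} {y : Rn n}
    (hy : y ∈ cylinder e l ρ δ) : ‖y‖ < ρ + δ := by
  have h : ‖y‖ ≤ ‖y - l y • e‖ + ‖l y • e‖ := by
    simpa using norm_add_le (y - l y • e) (l y • e)
  rw [norm_smul, hc.cone.norm_axis, mul_one, Real.norm_eq_abs] at h
  linarith [hy.1, hy.2]

theorem add_smul_mem_cylinder (hc : g.IsConeChart φ e l K L m) {ρ δ : ℝ} {y : Rn n}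
    (hy : y ∈ cylinder e l ρ δ) {s : ℝ} (hs : |l y + s| < δ) :
    y + s • e ∈ cylinder e l ρ δ := by
  have hl : l (y + s • e) = l y + s := by simp [hc.cone.apply_axis]
  refine ⟨?_, by rwa [hl]⟩
  have : y + s • e - l (y + s • e) • e = y - l y • e := by rw [hl]; module
  rw [this]
  exact hy.1

/-- A horizon through the centre of a cone chart is the zero set of a function which is negative at
the bottom and positive at the top of a small cylinder. -/
theorem exists_defining_function (hc : g.IsConeChart φ e l K L m) {H : Set M}
    (hH : g.IsHorizon H) {p : M} (hp : p ∈ H) (hpφ : p ∈ φ.source) (hp0 : φ p = 0) {ε : ℝ}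
    (hε : 0 < ε) :
    ∃ ρ > 0, ∃ δ > 0, ρ < ε ∧ δ < ε ∧ ∃ h : Rn n → ℝ,
      ContinuousOn h (Metric.ball 0 (2 * (ρ + δ))) ∧
      (∀ y ∈ cylinder e l ρ δ, h y = 0 ↔ φ.symm y ∈ H) ∧
      ∀ y : Rn n, ‖y‖ < ρ → h (y - δ • e) < 0 ∧ 0 < h (y + δ • e) := by
  obtain ⟨f, hpf, l', c', hl', hf⟩ := hH.hypersurface p hp
  have h0t : (0 : Rn n) ∈ φ.target := hp0 ▸ φ.map_source hpφ
  have hsymm0 : φ.symm 0 = p := by rw [← hp0, φ.left_inv hpφ]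
  have hV : φ.target ∩ φ.symm ⁻¹' f.source ∈ 𝓝 (0 : Rn n) :=
    (φ.isOpen_inter_preimage_symm f.open_source).mem_nhds ⟨h0t, by simpa [hsymm0] using hpf⟩
  obtain ⟨r, hr, hball⟩ := Metric.mem_nhds_iff.1 hV
  set h : Rn n → ℝ := fun y ↦ l' (f (φ.symm y)) - c' with hh
  have hcont : ContinuousOn h (Metric.ball 0 r) :=
    (l'.continuous.comp_continuousOn (f.continuousOn.comp
      (φ.continuousOn_symm.mono fun y hy ↦ (hball hy).1) fun y hy ↦ (hball hy).2)).sub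
      continuousOn_const
  have hzero : ∀ y ∈ Metric.ball (0 : Rn n) r, h y = 0 ↔ φ.symm y ∈ H := fun y hy ↦ by
    rw [hf _ (hball hy).2, hh, sub_eq_zero]
  have hlp : l' (f p) = c' := (hf p hpf).1 hp
  -- Moving away from `f p` in direction `v` in the flattening map changes `h` linearly, so `v` and
  -- `-v` give points of both signs arbitrarily close to the centre.
  have hfreq : ∀ v : Rn n, ∃ᶠ y in 𝓝 (0 : Rn n), ∃ s > 0, h y = s * l' v := by
    intro v
    have hfp : f p ∈ f.target := f.map_source hpf
    have hline : Tendsto (fun s : ℝ ↦ f p + s • v) (𝓝[>] 0) (𝓝 (f p)) := by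
      have : ContinuousAt (fun s : ℝ ↦ f p + s • v) 0 := by fun_prop
      simpa using this.tendsto.mono_left nhdsWithin_le_nhds
    have hx : Tendsto (fun s : ℝ ↦ f.symm (f p + s • v)) (𝓝[>] 0) (𝓝 p) := by
      have := (f.continuousAt_symm hfp).tendsto.comp hline
      rwa [f.left_inv hpf] at this
    have hz : Tendsto (fun s : ℝ ↦ φ (f.symm (f p + s • v))) (𝓝[>] 0) (𝓝 0) := by
      have := (φ.continuousAt hpφ).tendsto.comp hx
      rwa [hp0] at this
    refine hz.frequently (Eventually.frequently ?_)
    filter_upwards [hline.eventually (f.open_target.mem_nhds hfp),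
      hx.eventually (φ.open_source.mem_nhds hpφ), self_mem_nhdsWithin] with s h1 h2 h3
    refine ⟨s, h3, ?_⟩
    simp only [hh]
    rw [φ.left_inv h2, f.right_inv h1, map_add, map_smul, hlp, smul_eq_mul, add_sub_cancel_left]
  obtain ⟨v, hv⟩ : ∃ v, 0 < l' v := by
    obtain ⟨v, hv⟩ : ∃ v, l' v ≠ 0 := by
      by_contra! hcon
      exact hl' (ContinuousLinearMap.ext hcon)
    rcases hv.lt_or_gt with hlt | hgt
    · exact ⟨-v, by simpa using hlt⟩
    · exact ⟨v, hgt⟩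
  -- Together with `ρ ≤ δ` this gives `2 * (ρ + δ) ≤ r / 2`, so the ball in the conclusion lies in
  -- the domain of `h`.
  set δ := min (r / 8) (ε / 2) with hδ
  have hδ0 : 0 < δ := lt_min (by linarith) (by linarith)
  have hδr : δ ≤ r / 8 := min_le_left _ _
  obtain ⟨σ, hσ, hsign⟩ := exists_sign_change hc.cone.norm_axis hcont
    ((hzero 0 (Metric.mem_ball_self hr)).2 (hsymm0 ▸ hp))
    -- Two zeros on an axis line would be chronologically related points of `H`.
    (fun y hy s hs hy' hcon ↦ hH.achronal _ ((hzero _ hy').1 hcon.2) _ ((hzero y hy).1 hcon.1)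
      (g.chronPast_mono (subset_univ φ.source) _
        (hc.segment_mem_chronPast hs (hball hy).1 (hball hy').1)))
    ((hfreq v).mono fun y ⟨s, hs, hy⟩ ↦ hy ▸ mul_pos hs hv)
    ((hfreq (-v)).mono fun y ⟨s, hs, hy⟩ ↦ by
      rw [hy, map_neg]
      exact mul_neg_of_pos_of_neg hs (neg_lt_zero.2 hv))
    hδ0 (by linarith)
  obtain ⟨ρ₀, hρ₀, hρ⟩ := Metric.eventually_nhds_iff.1 hsign
  set ρ := min ρ₀ δ with hρdef
  have hρδ : ρ ≤ δ := min_le_right _ _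
  have hδε : δ ≤ ε / 2 := min_le_right _ _
  refine ⟨ρ, lt_min hρ₀ hδ0, δ, hδ0, by linarith, by linarith, fun y ↦ σ * h y,
    continuousOn_const.mul (hcont.mono (Metric.ball_subset_ball (by linarith))),
    fun y hy ↦ ?_, fun y hy ↦ hρ (by simpa using hy.trans_le (min_le_left _ _))⟩
  have := hc.norm_lt_of_mem_cylinder hy
  rw [mul_eq_zero, or_iff_right hσ, hzero y (by rw [mem_ball_zero_iff]; linarith)]

/-- A point slightly below a point `q` belongs to the Cauchy development of the part of a
hyperplane in the chronological past of `q`. -/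
theorem mem_cauchyDevelopment (hc : g.IsConeChart φ e l K L m) {y : Rn n} {s c R : ℝ} {S : Set M}
    (hy : y ∈ φ.target) (hs : 0 < s) (hsR : R + s < 1) (hcy : c < l y)
    (hyR : ‖y‖ + K * (l y - c) ≤ R)
    (hS : g.chronPast φ.source (φ.symm (y + s • e)) ∩ chartHyperplane φ l c ⊆ S) :
    φ.symm y ∈ g.cauchyDevelopment φ.source S := by
  refine ⟨φ.map_target hy, fun γ b hγ ↦ ?_⟩
  have hφz : φ (φ.symm y) = y := φ.right_inv hy
  obtain ⟨T, hT, hT0, hTc, hTR⟩ := hc.exists_apply_eq hγ (c := c) (R := R) (by linarith)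
    (by rwa [hφz]) (by rwa [hφz])
  obtain ⟨-, hpw, hU, hγ0, -⟩ := hγ
  have hsub := Icc_subset_rayDomain hT
  have hmem := hc.mem_chronPast_of_causal (c := c) hT0 (hpw.mono hsub)
    (fun t ht ↦ hU t (hsub ht)) (s := s) (fun t ht ↦ by linarith [hTR t ht]) hs
    (by rwa [hγ0, hφz]) hTc
  rw [hγ0, hφz] at hmem
  exact ⟨T, hT, hS ⟨hmem, hU T hT, hTc⟩⟩

/-- A point above a point of a horizon does not belong to the Cauchy development of a set which
is disjoint from the horizon and lies on a hyperplane further down. -/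
theorem notMem_cauchyDevelopment [T2Space M] (hc : g.IsConeChart φ e l K L m) {H : Set M}
    (hH : g.IsHorizon H) {y : Rn n} {s c : ℝ} {S : Set M} (hy : y ∈ φ.target) (hs : 0 < s)
    (hy' : y - s • e ∈ φ.target) (hcy : c < l (y - s • e)) (hyH : φ.symm (y - s • e) ∈ H)
    (hS : S ⊆ chartHyperplane φ l c) (hSH : ∀ x ∈ S, x ∉ H) :
    φ.symm y ∉ g.cauchyDevelopment φ.source S := by
  intro hD
  obtain ⟨γ, b, hb, hgeo, hvel, hγH, hγ0, hend⟩ := hH.generator _ hyH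
  obtain ⟨b', hb'b, hb', hU, hend'⟩ := exists_truncation φ.open_source hb
    hgeo.1.continuousOn (hγ0 ▸ φ.map_target hy') hend
  have hseg := fun t ht ↦ hc.segment_mem_target hy hy' (t := t) ht
  have hjoin : φ.symm (y - ((1 : ℝ) * s) • e) = γ 0 := by rw [one_mul, hγ0]
  -- The axis segment down to `H`, followed by the generator cut off at its exit from the chart.
  have hinext := isPastInextendibleCausal_concat (g := g)
    (γ₁ := fun t ↦ φ.symm (y - (t * s) • e)) (γ₂ := γ) hb' hjoin
    (fun t ht ↦ φ.map_target (hseg t ht)) hU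
    (fun a a' haa hsub ↦ by
      have := hc.isSmoothDirected_segment hs haa fun t ht ↦ hseg t (hsub ht)
      exact ⟨this.1, fun t ht ↦ pastTimelike_subset_pastCausal _ (this.2 t ht)⟩)
    (fun a a' haa hsub ↦ isSmoothDirected_of_subset hgeo.1
      (fun t ht ↦ ⟨(hvel t ht).1, (hvel t ht).2.1.le, (hvel t ht).2.2⟩) haa
      (hsub.trans (rayDomain_mono hb'b))) hend'
  simp only [zero_mul, zero_smul, sub_zero] at hinext
  obtain ⟨t, ht, htS⟩ := hD.2 _ _ hinext
  rcases le_total t 1 with h1 | h1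
  · rw [concat_of_le h1] at htS
    have heq := (hS htS).2
    rw [φ.right_inv (hseg t ⟨ht.1, h1⟩)] at heq
    simp only [map_sub, map_smul, hc.cone.apply_axis, smul_eq_mul, mul_one] at heq hcy
    have : t * s ≤ s := mul_le_of_le_one_left hs.le h1
    linarith
  · rw [concat_of_ge hjoin h1] at htS
    refine hSH _ htS (hγH _ ⟨by linarith, ?_⟩)
    have h3 := coe_add_one_lt_add_one_iff (b := b') (t := t - 1)
    rw [sub_add_cancel] at h3
    exact (h3.1 ht.2).trans_le hb'b

end IsConeChart

end TimeOrientedLorentzMetric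

/-! ### The horizon as a local Cauchy horizon -/

open TimeOrientedLorentzMetric in
theorem mainTheorem2 {n : ℕ} {M : Type*} [TopologicalSpace M] [T2Space M]
    [ChartedSpace (Rn n) M] [IsManifold 𝓘(ℝ, Rn n) ∞ M]
    (g : TimeOrientedLorentzMetric n M) (H : Set M) (hH : g.IsHorizon H) (p : M) (hp : p ∈ H) :
    ∃ φ ∈ IsManifold.maximalAtlas 𝓘(ℝ, Rn n) ∞ M, p ∈ φ.source ∧ φ.target = Metric.ball 0 1 ∧
      ∃ (l : Rn n →L[ℝ] ℝ) (c : ℝ), g.IsSpacelikeHyperplane φ l c ∧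
        ∃ Up : Set M, IsOpen Up ∧ p ∈ Up ∧ closure Up ⊆ φ.source ∧
          ∃ S : Set M,
            S = (⋃ q ∈ closure Up ∩ H,
              g.chronPast φ.source q ∩ TimeOrientedLorentzMetric.chartHyperplane φ l c) ∧
            g.IsAchronal φ.source S ∧
            H ∩ Up = g.cauchyHorizon φ.source S ∩ Up := by
  obtain ⟨φ, hφ, hpφ, hp0, htarget, e, l, K, L, m, hcone⟩ := g.exists_coneChart p
  have hc : g.IsConeChart φ e l K L m := ⟨hφ, htarget, htarget ▸ hcone⟩
  have hK1 : 1 ≤ K := hc.cone.one_le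
  have hK : 0 < K := by linarith
  -- With `ρ, δ < d / 2` the cylinder lies above `l = -d` and in the ball of radius `1 / 8`. A
  -- causal curve from it moves by at most `K * (2 * d) = 1 / 4` before reaching that level.
  set d := 1 / (8 * K) with hd
  have hd0 : 0 < d := by positivity
  have hKd : K * d = 1 / 8 := by rw [hd]; field_simp
  have hd8 : d ≤ 1 / 8 := by nlinarith
  obtain ⟨ρ, hρ, δ, hδ, hρd, hδd, h, hcont, hzero, hsign⟩ :=
    hc.exists_defining_function hH hp hpφ hp0 (half_pos hd0)
  have hle := hc.cone.apply_axis
  have hnorm : ∀ y ∈ cylinder e l ρ δ, ‖y‖ < 1 / 8 := fun y hy ↦ by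
    linarith [hc.norm_lt_of_mem_cylinder hy]
  have hcyl : cylinder e l ρ δ ⊆ φ.target := fun y hy ↦
    hc.mem_target.2 (by linarith [hnorm y hy])
  have hneg : ∀ y ∈ cylinder e l ρ δ, -d < l y := fun y hy ↦ by linarith [(abs_lt.1 hy.2).1]
  set Up := φ.source ∩ φ ⁻¹' cylinder e l ρ δ
  have hUpsymm : ∀ y ∈ cylinder e l ρ δ, φ.symm y ∈ Up := fun y hy ↦
    ⟨φ.map_target (hcyl hy), by rwa [mem_preimage, φ.right_inv (hcyl hy)]⟩
  set S := ⋃ q ∈ closure Up ∩ H, g.chronPast φ.source q ∩ chartHyperplane φ l (-d)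
  have hSsub : S ⊆ chartHyperplane φ l (-d) := iUnion₂_subset fun q _ ↦ inter_subset_right
  have hSH : ∀ x ∈ S, x ∉ H := by
    intro x hx hxH
    obtain ⟨q, hq, hxq⟩ := mem_iUnion₂.1 hx
    exact hH.achronal x hxH q hq.2 (g.chronPast_mono (subset_univ _) q hxq.1)
  have hbelow : ∀ y ∈ cylinder e l ρ δ, ∀ s > (0 : ℝ), y + s • e ∈ cylinder e l ρ δ →
      φ.symm (y + s • e) ∈ H → φ.symm y ∈ g.cauchyDevelopment φ.source S := by
    intro y hy s hs hy' hyH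
    have hly := abs_lt.1 hy.2
    -- Here `1 / 8 + 1 / 4 ≤ R`, and the height `s < 2 * δ < d ≤ 1 / 8` leaves `R + s < 1`.
    refine hc.mem_cauchyDevelopment (c := -d) (R := 1 / 2) (hcyl hy) hs ?_ (hneg y hy) ?_
      (subset_biUnion_of_mem (u := fun q ↦ g.chronPast φ.source q ∩ chartHyperplane φ l (-d))
        ⟨subset_closure (hUpsymm _ hy'), hyH⟩)
    · have h1 := (abs_lt.1 hy'.2).2
      rw [map_add, map_smul, hle, smul_eq_mul, mul_one] at h1
      linarith
    · have h1 : K * (l y - -d) ≤ K * (2 * d) := by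
        gcongr
        linarith
      linarith [hnorm y hy]
  have habove : ∀ y ∈ cylinder e l ρ δ, ∀ s > (0 : ℝ), y - s • e ∈ cylinder e l ρ δ →
      φ.symm (y - s • e) ∈ H → φ.symm y ∉ g.cauchyDevelopment φ.source S :=
    fun y hy s hs hy' hyH ↦ hc.notMem_cauchyDevelopment hH (hcyl hy) hs (hcyl hy') (hneg _ hy')
      hyH hSsub hSH
  -- The axis line through `y` is parametrised by the value of `l`, so that `y` sits at `t = l y`
  -- and the ends of the cylinder at `±δ`.
  have hline : ∀ y ∈ cylinder e l ρ δ,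
      ContinuousOn (fun t : ℝ ↦ h (y - l y • e + t • e)) (Icc (-δ) δ) ∧
      h (y - l y • e + (-δ) • e) < 0 ∧ 0 < h (y - l y • e + δ • e) := by
    intro y hy
    refine ⟨hcont.comp (by fun_prop) fun t ht ↦ ?_, ?_, (hsign _ hy.1).2⟩
    · rw [mem_ball_zero_iff]
      refine (norm_add_le _ _).trans_lt ?_
      rw [norm_smul, hc.cone.norm_axis, mul_one, Real.norm_eq_abs]
      linarith [hy.1, abs_le.2 ht]
    · rw [neg_smul, ← sub_eq_add_neg]
      exact (hsign _ hy.1).1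
  have hself : ∀ y : Rn n, y - l y • e + l y • e = y := fun y ↦ sub_add_cancel _ _
  have hD_of_neg : ∀ y ∈ cylinder e l ρ δ, h y < 0 →
      φ.symm y ∈ g.cauchyDevelopment φ.source S := by
    intro y hy hlt
    obtain ⟨h1, -, h3⟩ := hline y hy
    have hly := abs_lt.1 hy.2
    obtain ⟨t, ht, hz⟩ := intermediate_value_Ioo hly.2.le
      (h1.mono (Icc_subset_Icc hly.1.le le_rfl))
      (show (0 : ℝ) ∈ Ioo _ _ from ⟨by rwa [hself], h3⟩)
    have heq : y - l y • e + t • e = y + (t - l y) • e := by module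
    have hmem : y + (t - l y) • e ∈ cylinder e l ρ δ := hc.add_smul_mem_cylinder hy (by
      rw [add_sub_cancel, abs_lt]
      exact ⟨hly.1.trans ht.1, ht.2⟩)
    exact hbelow y hy (t - l y) (sub_pos.2 ht.1) hmem ((hzero _ hmem).1 (heq ▸ hz))
  have hD_of_pos : ∀ y ∈ cylinder e l ρ δ, 0 < h y →
      φ.symm y ∉ g.cauchyDevelopment φ.source S := by
    intro y hy hlt
    obtain ⟨h1, h2, -⟩ := hline y hy
    have hly := abs_lt.1 hy.2
    obtain ⟨t, ht, hz⟩ := intermediate_value_Ioo hly.1.le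
      (h1.mono (Icc_subset_Icc le_rfl hly.2.le))
      (show (0 : ℝ) ∈ Ioo _ _ from ⟨h2, by rwa [hself]⟩)
    have heq : y - l y • e + t • e = y - (l y - t) • e := by module
    have hmem : y - (l y - t) • e ∈ cylinder e l ρ δ := by
      have := hc.add_smul_mem_cylinder hy (s := t - l y) (by
        rw [add_sub_cancel, abs_lt]
        exact ⟨ht.1, ht.2.trans hly.2⟩)
      convert this using 1
      module
    exact habove y hy (l y - t) (sub_pos.2 ht.2) hmem ((hzero _ hmem).1 (heq ▸ hz))
  refine ⟨φ, hφ, hpφ, htarget, l, -d, ⟨?_, fun y hy _ u hu hu0 ↦ ?_⟩, Up,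
    φ.isOpen_inter_preimage (isOpen_cylinder ρ δ), ⟨hpφ, ?_⟩, ?_, S, rfl, ?_, ?_⟩
  · rintro rfl
    simp at hle
  · by_contra hcon
    have := hc.cone.norm_le y hy u (not_lt.1 hcon)
    rw [hu, abs_zero, mul_zero] at this
    exact hu0 (norm_le_zero_iff.1 this)
  · rw [mem_preimage, hp0]
    exact ⟨by simpa using hρ, by simpa using hδ⟩
  · have hsub : Metric.closedBall (0 : Rn n) (1 / 8) ⊆ φ.target := fun y hy ↦
      hc.mem_target.2 (by rw [mem_closedBall_zero_iff] at hy; linarith)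
    have hcomp : IsCompact (φ.symm '' Metric.closedBall (0 : Rn n) (1 / 8)) :=
      (isCompact_closedBall _ _).image_of_continuousOn (φ.continuousOn_symm.mono hsub)
    refine (closure_minimal ?_ hcomp.isClosed).trans ?_
    · rintro x ⟨hx, hxc⟩
      exact ⟨φ x, by rw [mem_closedBall_zero_iff]; exact (hnorm _ hxc).le, φ.left_inv hx⟩
    · rintro _ ⟨y, hy, rfl⟩
      exact φ.map_target (hsub hy)
  -- Chronological precedence strictly lowers `l`, which is constant on `S`.
  · intro x hx y hy hxy
    have := hc.apply_lt_of_mem_chronPast hxy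
    rw [(hSsub hx).2, (hSsub hy).2] at this
    exact this.false
  · ext x
    refine and_congr_left fun ⟨hxφ, hxc⟩ ↦ ?_
    have hxc' : φ x ∈ cylinder e l ρ δ := hxc
    have hsx : φ.symm (φ x) = x := φ.left_inv hxφ
    have hy := φ.map_source hxφ
    constructor
    -- Points just below `x` on its axis line lie in the Cauchy development and points just above do
    -- not, so `x` is a frontier point.
    · intro hxH
      have hcyl_ev : ∀ s : ℝ, Tendsto (fun τ : ℝ ↦ φ x + (s * τ) • e) (𝓝[>] 0) (𝓝 (φ x)) := by
        intro s
        have : ContinuousAt (fun τ : ℝ ↦ φ x + (s * τ) • e) 0 := by fun_prop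
        simpa using this.tendsto.mono_left nhdsWithin_le_nhds
      have hlim : ∀ s : ℝ, Tendsto (fun τ : ℝ ↦ φ.symm (φ x + (s * τ) • e)) (𝓝[>] 0) (𝓝 x) := by
        intro s
        have := (φ.continuousAt_symm hy).tendsto.comp (hcyl_ev s)
        rwa [hsx] at this
      have hopen := (isOpen_cylinder (e := e) (l := l) ρ δ).mem_nhds hxc'
      refine ⟨hxφ, ?_, ?_⟩
      · rw [frontier_eq_closure_inter_closure]
        constructor
        · refine mem_closure_of_tendsto (hlim (-1)) ?_
          filter_upwards [(hcyl_ev (-1)).eventually hopen, self_mem_nhdsWithin] with s h1 h2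
          have hback : φ x + (-1 * s) • e + s • e = φ x := by module
          exact hbelow _ h1 s h2 (by rwa [hback]) (by rwa [hback, hsx])
        · refine mem_closure_of_tendsto (hlim 1) ?_
          filter_upwards [(hcyl_ev 1).eventually hopen, self_mem_nhdsWithin] with s h1 h2
          have hback : φ x + (1 * s) • e - s • e = φ x := by module
          exact habove _ h1 s h2 (by rwa [hback]) (by rwa [hback, hsx])
      · rw [mem_closure_iff_nhds]
        push Not
        refine ⟨φ.source ∩ φ ⁻¹' {y | -d < l y}, (φ.isOpen_inter_preimage
          (isOpen_lt continuous_const l.continuous)).mem_nhds ⟨hxφ, hneg _ hxc'⟩, ?_⟩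
        rw [eq_empty_iff_forall_notMem]
        rintro z ⟨hz, hzS⟩
        exact (hSsub hzS).2.not_gt hz.2
    -- Off `H` the function `h` has constant sign near `φ x`, so a whole neighbourhood of `x` lies
    -- inside or outside the Cauchy development.
    · rintro ⟨-, hfr, -⟩
      by_contra hxH
      have hne : h (φ x) ≠ 0 := fun hz ↦ hxH (hsx ▸ (hzero _ hxc').1 hz)
      have hcx : ContinuousAt h (φ x) := hcont.continuousAt (Metric.isOpen_ball.mem_nhds (by
        rw [mem_ball_zero_iff]
        linarith [hc.norm_lt_of_mem_cylinder hxc']))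
      have hφx := (φ.continuousAt hxφ).tendsto
      have hev := (hφx.eventually ((isOpen_cylinder (e := e) (l := l) ρ δ).mem_nhds hxc')).and
        (φ.open_source.mem_nhds hxφ)
      rcases hne.lt_or_gt with hlt | hgt
      · refine hfr.2 (mem_interior_iff_mem_nhds.2 ?_)
        filter_upwards [hev, hφx.eventually (hcx.eventually (gt_mem_nhds hlt))] with z h1 h2
        exact φ.left_inv h1.2 ▸ hD_of_neg _ h1.1 h2
      · refine mem_closure_iff_frequently.1 hfr.1 ?_
        filter_upwards [hev, hφx.eventually (hcx.eventually (lt_mem_nhds hgt))] with z h1 h2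
        exact φ.left_inv h1.2 ▸ hD_of_pos _ h1.1 h2

end
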